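/- Let $F$ be a finite field of order $q$ and let $\mathrm{Irr}(q)$ be the set of monic irreducible polynomials over $F$. For $X\in \mathrm{M}(n,q)$ (the $n\times n$ matrices over $F$, acting on row vectors $F^n$) and $h\in\mathrm{Irr}(q)$, let $V_h$ be the $h$-primary component of $F^n$ under $X$, that is, the subspace of vectors annihilated by some power of $h(X)$. Write $V_h=V_1\oplus\cdots\oplus V_r$ with each $V_i$ a non-zero $X$-invariant cyclic subspace on which $X$ has minimal polynomial $h^{\lambda_i}$, where $\lambda_1\ge\cdots\ge\lambda_r\ge 1$; the partition $\lambda(X,h):=(\lambda_1,\dots,\lambda_r)$ is uniquely determined by $X$ and $h$, and is the empty partition $()$ if $V_h=0$. Let $\mathrm{Div}\,X$ be the set of $h\in\mathrm{Irr}(q)$ dividing the characteristic polynomial of $X$. For a partition $\lambda$ of a non-negative integer $|\lambda|$ and $h\in\mathrm{Irr}(q)$, put $c((),\deg h,q)=1$, and for $\lambda\ne()$ let $c(\lambda,\deg h,q)$ be the order of the centraliser in $\mathrm{GL}(s,q)$, $s=|\lambda|\deg h$, of any $X\in\mathrm{M}(s,q)$ with characteristic polynomial $h^{|\lambda|}$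 and $\lambda(X,h)=\lambda$ (this depends only on $\lambda$, $\deg h$ and $q$). Let $x_{h,\lambda}$ ($h\in\mathrm{Irr}(q)$, $\lambda$ a partition) be independent indeterminates. For a finite subset $I\subseteq\mathrm{Irr}(q)$, the $I$-cycle index of $\mathrm{M}(n,q)$ is the polynomial \[Z^{(I)}_{\mathrm{M}(n,q)}(\mathbf{x}):=\frac{1}{|\mathrm{GL}(n,q)|}\sum_{X\in \mathrm{M}(n,q)}\ \prod_{h\in(\mathrm{Div}\,X)\cup I}x_{h,\lambda(X,h)}.\] Theorem (the $I$-Cycle Index Theorem). For every finite subset $I\subseteq\mathrm{Irr}(q)$, in the ring of formal power series in $u$ over $\mathbb{Q}[x_{h,\lambda}]$ (where the infinite sums and the infinite product on the right converge coefficient by coefficient), \[\prod_{h\in I}x_{h,()}+\sum_{n=1}^{\infty} Z_{\mathrm{M}(n,q)}^{(I)}(\mathbf{x})\,u^n = \prod_{h\in \mathrm{Irr}(q)\setminus I} \left(1+\sum_{\lambda\neq ()} x_{h,\lambda}\frac{u^{|\lambda|\deg h}}{c(\lambda,\deg h,q)} \right)\cdot\prod_{h\in I} \left(x_{h,()}+\sum_{\lambda\neq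 ()} x_{h,\lambda}\frac{u^{|\lambda|\deg h}}{c(\lambda,\deg h,q)} \right),\] where the sums on the right run over all partitions $\lambda\ne()$. -/

import Mathlib

open scoped PowerSeries.WithPiTopology

namespace CycleIndex

/-- `Irr F`: the monic irreducible polynomials over the field `F`. -/
abbrev Irr (F : Type*) [Field F] : Type _ :=
  {h : Polynomial F // h.Monic ∧ Irreducible h}

/-- Partitions of non-negative integers: a pair `⟨m, p⟩` with `p` a partition of `m`. -/
abbrev Part : Type := Σ m : ℕ, Nat.Partition m

/-- The integer `|μ|` of which `μ` is a partition. -/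
abbrev Part.size (μ : Part) : ℕ := μ.1

/-- The empty partition `()`, the only partition of `0`. -/
abbrev Part.empty : Part := ⟨0, default⟩

/-- The `h`-primary component `V_h` of an endomorphism `f` of `V`: the vectors killed by some power
of `h(f)`. -/
noncomputable def primaryComponent {F V : Type*} [Field F] [AddCommGroup V] [Module F V]
    (f : Module.End F V) (h : Polynomial F) : Submodule F V :=
  ⨆ k : ℕ, LinearMap.ker (Polynomial.aeval f (h ^ k))

/-- `HasType f h μ`: the `h`-primary component of `f` is an internal direct sum of `f`-invariant
subspaces `W 0, …, W (r - 1)`, each of them cyclic as a module for `f`, such that the restriction of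
`f` to `W i` has minimal polynomial `h ^ e i`, and `e 0, …, e (r - 1)` are, up to order, the parts
of `μ` (which are positive). -/
def HasType {F V : Type*} [Field F] [AddCommGroup V] [Module F V]
    (f : Module.End F V) (h : Polynomial F) (μ : Part) : Prop :=
  ∃ (r : ℕ) (e : Fin r → ℕ) (W : Fin r → Submodule F V) (hW : ∀ i, ∀ v ∈ W i, f v ∈ W i),
    Multiset.map e Finset.univ.val = μ.2.parts ∧
    iSupIndep W ∧
    ⨆ i, W i = primaryComponent f h ∧
    ∀ i, (∃ w : V, W i = Submodule.span F (Set.range fun k : ℕ => (f ^ k) w)) ∧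
      minpoly F (f.restrict (hW i)) = h ^ e i

/-- The partition `λ(X, h)` attached to a square matrix `X`, acting on row vectors by `v ↦ v X`, and
a monic irreducible polynomial `h`: the unique partition `μ` with `HasType _ h μ`. -/
noncomputable def lam {F : Type*} [Field F] {n : ℕ} (X : Matrix (Fin n) (Fin n) F) (h : Irr F) :
    Part :=
  @Classical.epsilon Part ⟨Part.empty⟩
    (fun μ => HasType (Matrix.vecMulLinear X : Module.End F (Fin n → F)) h.1 μ)

theorem finite_div {F : Type*} [Field F] {n : ℕ} (X : Matrix (Fin n) (Fin n) F) :
    {h : Irr F | h.1 ∣ X.charpoly}.Finite := by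
  classical
  have hX : X.charpoly ≠ 0 := X.charpoly_monic.ne_zero
  refine Set.Finite.of_finite_image (f := Subtype.val) ?_ Subtype.val_injective.injOn
  refine (UniqueFactorizationMonoid.normalizedFactors X.charpoly).toFinset.finite_toSet.subset ?_
  rintro _ ⟨h, hh, rfl⟩
  have hh : h.1 ∣ X.charpoly := hh
  simp only [Finset.mem_coe, Multiset.mem_toFinset]
  exact (Polynomial.mem_normalizedFactors_iff hX).2 ⟨h.2.2, h.2.1, hh⟩

/-- `Div X`: the monic irreducible polynomials dividing the characteristic polynomial of `X`. -/
noncomputable def Div {F : Type*} [Field F] {n : ℕ} (X : Matrix (Fin n) (Fin n) F) :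
    Finset (Irr F) :=
  (finite_div X).toFinset

/-- The order of the centraliser of `X` in `GL(s, F)`. -/
noncomputable def centralizerOrder {F : Type*} [Field F] {s : ℕ} (X : Matrix (Fin s) (Fin s) F) :
    ℕ :=
  Nat.card {g : GL (Fin s) F // (g : Matrix (Fin s) (Fin s) F) * X = X * g}

open Classical in
/-- `c(μ, d, q)` for a field `F` of order `q`: it is `1` for `μ = ()`, and otherwise the order of
the centraliser in `GL(s, F)`, `s = |μ| d`, of any matrix `X` of size `s` which, for some monic
irreducible `h` of degree `d`, has characteristic polynomial `h ^ |μ|` and `λ(X, h) = μ`. -/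
noncomputable def c (F : Type*) [Field F] (μ : Part) (d : ℕ) : ℕ :=
  if μ = Part.empty then 1
  else Classical.epsilon fun m : ℕ =>
    ∃ (h : Irr F) (X : Matrix (Fin (μ.size * d)) (Fin (μ.size * d)) F),
      h.1.natDegree = d ∧ X.charpoly = h.1 ^ μ.size ∧ lam X h = μ ∧ centralizerOrder X = m

/-- Polynomials over `ℚ` in the independent indeterminates `x_{h, μ}`. -/
abbrev CoeffRing (F : Type*) [Field F] : Type _ := MvPolynomial (Irr F × Part) ℚ

/-- The indeterminate `x_{h, μ}`. -/
noncomputable abbrev x {F : Type*} [Field F] (h : Irr F) (μ : Part) : CoeffRing F :=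
  MvPolynomial.X (h, μ)

open Classical in
/-- The `I`-cycle index `Z^{(I)}` of the algebra of `n × n` matrices over `F`. -/
noncomputable def Z {F : Type*} [Field F] [Fintype F] (I : Finset (Irr F)) (n : ℕ) : CoeffRing F :=
  MvPolynomial.C (1 / (Nat.card (GL (Fin n) F) : ℚ)) *
    ∑ X : Matrix (Fin n) (Fin n) F, ∏ h ∈ Div X ∪ I, x h (lam X h)

/-- The left-hand side: `∏_{h ∈ I} x_{h, ()} + ∑_{n ≥ 1} Z^{(I)}_n u ^ n`, a power series in `u`. -/
noncomputable def genFun {F : Type*} [Field F] [Fintype F] (I : Finset (Irr F)) :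
    PowerSeries (CoeffRing F) :=
  PowerSeries.mk fun n => if n = 0 then ∏ h ∈ I, x h Part.empty else Z I n

/-- The power series `x_{h, μ} u ^ {|μ| deg h} / c(μ, deg h, q)` in `u`. -/
noncomputable def term {F : Type*} [Field F] (h : Irr F) (μ : Part) : PowerSeries (CoeffRing F) :=
  PowerSeries.monomial (μ.size * h.1.natDegree)
    (MvPolynomial.C (1 / (c F μ h.1.natDegree : ℚ)) * x h μ)

end CycleIndex

namespace CycleIndex

open Polynomial

/-! ### Multisets of exponents and partitions -/

section Multiset

/-! A matrix turns the space of row vectors into an `F[X]`-module, and two matrices are similar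
exactly when these modules are isomorphic. Primary decomposition and the structure theorem over
`F[X]` identify the module of A with the product of the modules `Q h (lam A h)` (`rowModule_equiv`),
and the partitions can be recovered from the sizes of h^k M (`eq_of_pi_Q_equiv`). So similarity
classes of n × n matrices correspond to families of partitions λ_h, almost all empty, with ∑ |λ_h|
deg h = n.

By orbit-stabiliser, a class has |GL(n,q)| / |Aut M| members. There are no non-zero maps between
components at different primes, so |Aut M| is the product of the |Aut Q(h, λ_h)|. Each factor equals
c(λ_h, deg h, q) (`c_eq_autCard`); the delicate point is that it depends on h only through its
degree (`autCard_Q_eq`), which a well-chosen substitution X ↦ γ shows. Thus a family (λ_h)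
contributes ∏ x_{h,λ_h} / c(λ_h, deg h, q) to the cycle index, with x_{h,()} read as 1 when h ∉ I.
This is precisely its contribution to the coefficient of u^n in the expanded product
(`Z_eq_coeff_prod`).

Only irreducibles of degree at most n and partitions of size at most n affect that coefficient, so
the count is finite and the partial products stabilise coefficient by coefficient. -/

theorem count_succ_add_two_mul_sum_tsub (s : Multiset ℕ) (k : ℕ) :
    s.count (k + 1) + 2 * (s.map fun e => e - (k + 1)).sum =
      (s.map fun e => e - k).sum + (s.map fun e => e - (k + 2)).sum := by
  induction s using Multiset.induction with
  | empty => simp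
  | cons a s ih =>
    simp only [Multiset.count_cons, Multiset.map_cons, Multiset.sum_cons]
    split_ifs <;> omega

/-- The second difference of k ↦ ∑ (e - k) is the multiplicity of k + 1, and the constants a and b
vanish under it. In the application they are the contributions of the components at other primes. -/
theorem eq_of_mul_sum_tsub_eq {s t : Multiset ℕ} (hs : 0 ∉ s) (ht : 0 ∉ t) {a b d : ℕ} (hd : 0 < d)
    (H : ∀ k, a + d * (s.map fun e => e - k).sum = b + d * (t.map fun e => e - k).sum) :
    s = t := by
  have hmul : ∀ (s : Multiset ℕ) (k : ℕ), d * s.count (k + 1) +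
      2 * (d * (s.map fun e => e - (k + 1)).sum) =
      d * (s.map fun e => e - k).sum + d * (s.map fun e => e - (k + 2)).sum := by
    intro s k
    rw [← mul_add, ← count_succ_add_two_mul_sum_tsub]
    ring
  ext m
  rcases m with _ | k
  · rw [Multiset.count_eq_zero_of_notMem hs, Multiset.count_eq_zero_of_notMem ht]
  · refine Nat.eq_of_mul_eq_mul_left hd ?_
    linarith [hmul s k, hmul t k, H k, H (k + 1), H (k + 2)]

theorem exists_equiv_of_map_univ_eq {ι κ α : Type*} [Fintype ι] [Fintype κ] (e : ι → α) (e' : κ → α)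
    (H : Multiset.map e Finset.univ.val = Multiset.map e' Finset.univ.val) :
    ∃ σ : ι ≃ κ, ∀ i, e' (σ i) = e i := by
  classical
  have key : ∀ a, Nonempty ({i // e i = a} ≃ {j // e' j = a}) := by
    intro a
    refine ⟨Fintype.equivOfCardEq ?_⟩
    have := congrArg (Multiset.count a) H
    rw [Multiset.count_map, Multiset.count_map] at this
    rw [Fintype.card_subtype, Fintype.card_subtype]
    simp only [Finset.card_def, Finset.filter_val]
    simpa only [eq_comm] using this
  have g := fun a => (key a).some
  refine ⟨(Equiv.sigmaFiberEquiv e).symm.trans ((Equiv.sigmaCongrRight g).trans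
    (Equiv.sigmaFiberEquiv e')), fun i => ?_⟩
  exact (g (e i) ⟨i, rfl⟩).2

theorem zero_notMem_parts (μ : Part) : 0 ∉ μ.2.parts := fun h => (μ.2.parts_pos h).ne' rfl

theorem part_ext {μ ν : Part} (h : μ.2.parts = ν.2.parts) : μ = ν := by
  obtain ⟨m, p⟩ := μ
  obtain ⟨n, q⟩ := ν
  have hmn : m = n := by rw [← p.parts_sum, ← q.parts_sum]; exact congrArg _ h
  subst hmn
  congr 1
  exact Nat.Partition.ext h

theorem eq_empty_of_size_eq_zero {μ : Part} (h : μ.size = 0) : μ = Part.empty := by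
  obtain ⟨m, p⟩ := μ
  obtain rfl : m = 0 := h
  exact congrArg _ (Subsingleton.elim _ _)

end Multiset

/-! ### Model primary modules -/

section Model
variable {F : Type*} [Field F]

/-- The module `∏ i, F[X] / (h ^ e i)`. -/
abbrev Model {ι : Type*} (h : F[X]) (e : ι → ℕ) : Type _ := ∀ i, F[X] ⧸ Ideal.span {h ^ e i}

/-- The `h`-primary module of type `μ`. -/
abbrev Q (h : F[X]) (μ : Part) : Type _ :=
  Model h (fun i : μ.2.parts.ToType => i.1)

theorem model_reindex {ι κ : Type*} [Fintype ι] [Fintype κ] (h : F[X]) (e : ι → ℕ) (e' : κ → ℕ)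
    (H : Multiset.map e Finset.univ.val = Multiset.map e' Finset.univ.val) :
    Nonempty (Model h e ≃ₗ[F[X]] Model h e') := by
  obtain ⟨σ, hσ⟩ := exists_equiv_of_map_univ_eq e e' H
  have h1 : Model h e ≃ₗ[F[X]] ∀ i, F[X] ⧸ Ideal.span {h ^ e' (σ i)} :=
    LinearEquiv.piCongrRight fun i => Submodule.quotEquivOfEq _ _ (by rw [hσ])
  exact ⟨h1.trans (LinearEquiv.piCongrLeft F[X] (fun j => F[X] ⧸ Ideal.span {h ^ e' j}) σ)⟩

theorem model_equiv_Q {ι : Type*} [Fintype ι] (h : F[X]) (e : ι → ℕ) (μ : Part)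
    (H : Multiset.map e Finset.univ.val = μ.2.parts) :
    Nonempty (Model h e ≃ₗ[F[X]] Q h μ) :=
  model_reindex h e _ (H.trans (Multiset.map_univ_coe _).symm)

theorem finite_quotient {g : F[X]} (hg : g.Monic) : Module.Finite F (F[X] ⧸ Ideal.span {g}) :=
  hg.finite_quotient

theorem finrank_model {ι : Type*} [Fintype ι] {h : F[X]} (hm : h.Monic) (e : ι → ℕ) :
    Module.finrank F (Model h e) = h.natDegree * ∑ i, e i := by
  have : ∀ i, Module.Finite F (F[X] ⧸ Ideal.span {h ^ e i}) :=
    fun i => finite_quotient (hm.pow _)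
  rw [Module.finrank_pi_fintype, Finset.mul_sum]
  refine Finset.sum_congr rfl fun i _ => ?_
  rw [finrank_quotient_span_eq_natDegree, natDegree_pow, mul_comm]

theorem finrank_Q {h : F[X]} (hm : h.Monic) (μ : Part) :
    Module.finrank F (Q h μ) = μ.size * h.natDegree := by
  rw [finrank_model hm, mul_comm]
  congr 1
  exact (Multiset.sum_eq_sum_coe _).symm.trans μ.2.parts_sum

instance finite_Q (h : Irr F) (μ : Part) : Module.Finite F (Q h.1 μ) := by
  have : ∀ i : μ.2.parts.ToType, Module.Finite F (F[X] ⧸ Ideal.span {h.1 ^ i.1}) :=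
    fun i => finite_quotient (h.2.1.pow _)
  exact Module.Finite.pi

theorem natDegree_pos (h : Irr F) : 0 < h.1.natDegree := h.2.2.natDegree_pos

theorem isCoprime_of_ne {h h' : Irr F} (hne : h ≠ h') : IsCoprime h.1 h'.1 := by
  refine (h.2.2.coprime_iff_not_dvd).2 fun hd => hne (Subtype.ext ?_)
  exact eq_of_monic_of_associated h.2.1 h'.2.1 (h.2.2.associated_of_dvd h'.2.2 hd)

theorem pow_smul_Q_eq_zero {h : F[X]} {μ : Part} {N : ℕ} (hN : μ.size ≤ N) (x : Q h μ) :
    h ^ N • x = 0 := by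
  funext i
  have hi : i.1 ≤ N := by
    refine le_trans ?_ hN
    exact (Multiset.single_le_sum (fun _ _ => Nat.zero_le _) _ Multiset.coe_mem).trans
      μ.2.parts_sum.le
  obtain ⟨y, hy⟩ := Ideal.Quotient.mk_surjective (x i)
  rw [Pi.smul_apply, ← hy, ← Ideal.Quotient.mk_eq_mk, ← Submodule.Quotient.mk_smul,
    Pi.zero_apply, Submodule.Quotient.mk_eq_zero, smul_eq_mul]
  exact Ideal.mul_mem_right _ _ (Ideal.mem_span_singleton.2 (pow_dvd_pow _ hi))

end Model

/-! ### The size of p • M as an isomorphism invariant -/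

section RangeCard
variable {R : Type*} [CommRing R]

/-- The cardinality of `p • M`. -/
noncomputable def rangeCard (p : R) (M : Type*) [AddCommGroup M] [Module R M] : ℕ :=
  Nat.card (Set.range fun x : M => p • x)

theorem rangeCard_congr (p : R) {M N : Type*} [AddCommGroup M] [Module R M] [AddCommGroup N]
    [Module R N] (g : M ≃ₗ[R] N) : rangeCard p M = rangeCard p N := by
  refine Nat.card_congr (g.toEquiv.subtypeEquiv fun a => ⟨?_, ?_⟩)
  · rintro ⟨x, rfl⟩
    exact ⟨g x, by simp⟩
  · rintro ⟨x, hx⟩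
    exact ⟨g.symm x, g.injective (by simpa using hx)⟩

theorem rangeCard_pi (p : R) {ι : Type*} [Fintype ι] (M : ι → Type*) [∀ i, AddCommGroup (M i)]
    [∀ i, Module R (M i)] : rangeCard p (∀ i, M i) = ∏ i, rangeCard p (M i) := by
  unfold rangeCard
  rw [← Nat.card_pi]
  have : (Set.range fun x : ∀ i, M i => p • x) =
      Set.pi Set.univ fun i => Set.range fun x : M i => p • x :=
    Set.range_piMap (fun i (x : M i) => p • x)
  rw [this]
  exact Nat.card_congr (Equiv.Set.univPi _)

end RangeCard

/-! ### Uniqueness of the partitions -/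

section Unique
variable {F : Type*} [Field F]

theorem card_quotient {g : F[X]} (hg : g.Monic) :
    Nat.card (F[X] ⧸ Ideal.span {g}) = Nat.card F ^ g.natDegree := by
  have := finite_quotient hg
  rw [Module.natCard_eq_pow_finrank (K := F), finrank_quotient_span_eq_natDegree]

/-- Multiplication by h^k from `F[X]` to the quotient has kernel (h^(e-k)); when k ≥ e, truncated
subtraction correctly gives the unit ideal. -/
theorem rangeCard_quotient_self {h : F[X]} (hm : h.Monic) (k e : ℕ) :
    rangeCard (h ^ k) (F[X] ⧸ Ideal.span {h ^ e}) = Nat.card F ^ (h.natDegree * (e - k)) := by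
  let φ : F[X] →ₗ[F[X]] F[X] ⧸ Ideal.span {h ^ e} :=
    (Submodule.mkQ (Ideal.span {h ^ e})).comp (LinearMap.lsmul F[X] F[X] (h ^ k))
  have hker : LinearMap.ker φ = Ideal.span {h ^ (e - k)} := by
    ext p
    simp only [φ, LinearMap.mem_ker, LinearMap.comp_apply, LinearMap.lsmul_apply,
      Submodule.mkQ_apply, Submodule.Quotient.mk_eq_zero, smul_eq_mul, Ideal.mem_span_singleton]
    rcases le_total k e with hk | hk
    · obtain ⟨j, rfl⟩ := Nat.exists_eq_add_of_le hk
      rw [pow_add, Nat.add_sub_cancel_left, mul_dvd_mul_iff_left (hm.pow _).ne_zero]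
    · rw [Nat.sub_eq_zero_of_le hk]
      simpa using (pow_dvd_pow h hk).mul_right p
  have hr : (Set.range fun x : F[X] ⧸ Ideal.span {h ^ e} => h ^ k • x) = LinearMap.range φ := by
    ext y
    constructor
    · rintro ⟨x, rfl⟩
      obtain ⟨x, rfl⟩ := Submodule.mkQ_surjective _ x
      exact ⟨x, map_smul (Submodule.mkQ _) _ _⟩
    · rintro ⟨x, rfl⟩
      exact ⟨Submodule.mkQ _ x, (map_smul (Submodule.mkQ _) _ _).symm⟩
  unfold rangeCard
  rw [hr, mul_comm, ← natDegree_pow, ← card_quotient (hm.pow _), ← hker]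
  exact (Nat.card_congr φ.quotKerEquivRange.toEquiv).symm

/-- Modulo g the element h is a unit, so multiplication by it is onto. -/
theorem rangeCard_quotient_of_isCoprime {h g : F[X]} (hg : g.Monic) (hc : IsCoprime h g) :
    rangeCard h (F[X] ⧸ Ideal.span {g}) = Nat.card F ^ g.natDegree := by
  rw [← card_quotient hg, rangeCard]
  refine (Nat.card_congr (Equiv.setCongr ?_)).trans (Nat.card_congr (Equiv.Set.univ _))
  refine Set.eq_univ_of_forall fun x => ?_
  obtain ⟨x, rfl⟩ := Submodule.mkQ_surjective _ x
  obtain ⟨a, b, hab⟩ := hc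
  refine ⟨Submodule.mkQ _ (a * x), ?_⟩
  change h • Submodule.mkQ _ (a * x) = _
  rw [← map_smul, Submodule.mkQ_apply, Submodule.mkQ_apply, Submodule.Quotient.eq,
    Ideal.mem_span_singleton]
  refine ⟨-(b * x), ?_⟩
  rw [smul_eq_mul]
  linear_combination x * hab

theorem rangeCard_Q_self (h : Irr F) (μ : Part) (k : ℕ) :
    rangeCard (h.1 ^ k) (Q h.1 μ) =
      Nat.card F ^ (h.1.natDegree * (μ.2.parts.map fun e => e - k).sum) := by
  rw [rangeCard_pi]
  simp only [rangeCard_quotient_self h.2.1]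
  rw [Finset.prod_pow_eq_pow_sum, ← Finset.mul_sum]
  congr 2
  rw [← Multiset.map_univ, Finset.sum]

theorem rangeCard_Q_of_ne {h h' : Irr F} (hne : h ≠ h') (μ : Part) (k : ℕ) :
    rangeCard (h.1 ^ k) (Q h'.1 μ) = Nat.card F ^ (h'.1.natDegree * μ.size) := by
  rw [rangeCard_pi]
  simp only [rangeCard_quotient_of_isCoprime (h'.2.1.pow _) (isCoprime_of_ne hne).pow]
  rw [Finset.prod_pow_eq_pow_sum]
  simp only [natDegree_pow]
  rw [← Finset.sum_mul, mul_comm]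
  congr 2
  exact (Multiset.sum_eq_sum_coe _).symm.trans μ.2.parts_sum

open Classical in
theorem rangeCard_pi_Q {S : Finset (Irr F)} (τ : Irr F → Part) (h : S) (k : ℕ) :
    rangeCard (h.1.1 ^ k) (∀ j : S, Q j.1.1 (τ j.1)) =
      Nat.card F ^ (∑ j ∈ S.erase h.1, j.1.natDegree * (τ j).size +
        h.1.1.natDegree * ((τ h.1).2.parts.map fun e => e - k).sum) := by
  rw [rangeCard_pi, Finset.prod_coe_sort S (fun j => rangeCard (h.1.1 ^ k) (Q j.1 (τ j))),
    ← Finset.prod_erase_mul S _ h.2, pow_add, rangeCard_Q_self, ← Finset.prod_pow_eq_pow_sum]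
  congr 1
  refine Finset.prod_congr rfl fun j hj => ?_
  exact rangeCard_Q_of_ne (Finset.ne_of_mem_erase hj).symm _ _

/-- Multiplying by h^k shrinks only the component at h. Since |F| > 1, the size of the image
determines its exponent, and these exponents for all k determine the partition. -/
theorem eq_of_pi_Q_equiv [Finite F] {S : Finset (Irr F)} {τ σ : Irr F → Part}
    (g : (∀ j : S, Q j.1.1 (τ j.1)) ≃ₗ[F[X]] (∀ j : S, Q j.1.1 (σ j.1))) (h : Irr F) (hh : h ∈ S) :
    τ h = σ h := by
  classical
  have key : ∀ k, _ := fun k => by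
    have := rangeCard_congr (h.1 ^ k) g
    rw [rangeCard_pi_Q τ ⟨h, hh⟩ k, rangeCard_pi_Q σ ⟨h, hh⟩ k] at this
    exact Nat.pow_right_injective (Finite.one_lt_card (α := F)) this
  exact part_ext (eq_of_mul_sum_tsub_eq (zero_notMem_parts _) (zero_notMem_parts _)
    (natDegree_pos h) key)

end Unique

/-! ### Automorphisms of products -/

section AutCard
variable {R : Type*} [CommRing R]

/-- The number of `R`-linear automorphisms of `M`. -/
noncomputable def autCard (R M : Type*) [CommRing R] [AddCommGroup M] [Module R M] : ℕ :=
  Nat.card (M ≃ₗ[R] M)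

theorem autCard_congr {M N : Type*} [AddCommGroup M] [Module R M] [AddCommGroup N] [Module R N]
    (g : M ≃ₗ[R] N) : autCard R M = autCard R N :=
  Nat.card_congr
    { toFun := fun f => (g.symm.trans f).trans g
      invFun := fun f => (g.trans f).trans g.symm
      left_inv := fun f => by ext; simp
      right_inv := fun f => by ext; simp }

/-- If there are no non-zero maps between different factors of a product, an endomorphism of
the product acts factor by factor. -/
theorem pi_apply_of_hom_eq_zero {ι : Type*} [Fintype ι] [DecidableEq ι] {M : ι → Type*}
    [∀ i, AddCommGroup (M i)] [∀ i, Module R (M i)]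
    (H : ∀ i j, i ≠ j → ∀ f : M i →ₗ[R] M j, f = 0) (f : (∀ i, M i) →ₗ[R] ∀ i, M i) (x : ∀ i, M i)
    (j : ι) : f x j = f (Pi.single j (x j)) j := by
  have hx : x = ∑ i, Pi.single i (x i) := (Finset.univ_sum_single x).symm
  conv_lhs => rw [hx, map_sum, Finset.sum_apply]
  refine Finset.sum_eq_single j (fun i _ hij => ?_) (by simp)
  exact LinearMap.congr_fun (H i j hij ((LinearMap.proj j).comp (f.comp (LinearMap.single R M i))))
    (x i)

theorem autCard_pi {ι : Type*} [Fintype ι] {M : ι → Type*}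
    [∀ i, AddCommGroup (M i)] [∀ i, Module R (M i)]
    (H : ∀ i j, i ≠ j → ∀ f : M i →ₗ[R] M j, f = 0) :
    autCard R (∀ i, M i) = ∏ i, autCard R (M i) := by
  classical
  unfold autCard
  rw [← Nat.card_pi]
  symm
  refine Nat.card_congr (Equiv.ofBijective (fun g => LinearEquiv.piCongrRight g) ⟨?_, ?_⟩)
  · intro g g' hg
    funext i
    ext x
    have := congrFun (LinearEquiv.congr_fun hg (Pi.single i x)) i
    simpa using this
  · intro f
    have key := pi_apply_of_hom_eq_zero H f.toLinearMap
    have key' := pi_apply_of_hom_eq_zero H f.symm.toLinearMap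
    refine ⟨fun i => LinearEquiv.ofLinearMap
      ((LinearMap.proj i).comp (f.toLinearMap.comp (LinearMap.single R M i)))
      ((LinearMap.proj i).comp (f.symm.toLinearMap.comp (LinearMap.single R M i))) ?_ ?_, ?_⟩
    · ext x
      have := key (f.symm (Pi.single i x)) i
      simpa using this.symm
    · ext x
      have := key' (f (Pi.single i x)) i
      simpa using this.symm
    · ext x i
      exact (key x i).symm

theorem hom_eq_zero_of_isCoprime {M N : Type*} [AddCommGroup M] [Module R M] [AddCommGroup N]
    [Module R N] {p q : R} (hc : IsCoprime p q) (hp : ∀ x : M, p • x = 0) (hq : ∀ x : N, q • x = 0)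
    (f : M →ₗ[R] N) : f = 0 := by
  obtain ⟨a, b, hab⟩ := hc
  ext x
  rw [LinearMap.zero_apply, ← one_smul R (f x), ← hab, add_smul, mul_smul, mul_smul, hq, ← map_smul,
    hp]
  simp

end AutCard

/-! ### Automorphism counts depend only on the degree of h -/

section Q
variable {F : Type*} [Field F]

theorem autCard_pi_Q (S : Finset (Irr F)) (τ : Irr F → Part) :
    autCard F[X] (∀ h : S, Q h.1.1 (τ h.1)) = ∏ h ∈ S, autCard F[X] (Q h.1 (τ h)) := by
  rw [← Finset.prod_coe_sort S (fun h => autCard F[X] (Q h.1 (τ h)))]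
  refine autCard_pi (M := fun h : S => Q h.1.1 (τ h.1)) fun i j hij => ?_
  have hc : IsCoprime (i.1.1 ^ (τ i.1).size) (j.1.1 ^ (τ j.1).size) :=
    (isCoprime_of_ne fun h => hij (Subtype.ext h)).pow
  have hi := fun x : Q i.1.1 (τ i.1) => pow_smul_Q_eq_zero le_rfl x
  have hj := fun x : Q j.1.1 (τ j.1) => pow_smul_Q_eq_zero le_rfl x
  exact hom_eq_zero_of_isCoprime hc hi hj

/-- A substitution `X ↦ γ` taking `h'` to a polynomial divisible by `h` exactly once. -/
theorem exists_aeval_eq_mul [Finite F] (h h' : Irr F) (hd : h.1.natDegree = h'.1.natDegree) :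
    ∃ γ w : F[X], aeval γ h'.1 = h.1 * w ∧ ¬ h.1 ∣ w := by
  have := Fact.mk h.2.2
  have := Fact.mk h'.2.2
  -- Finite extensions of F of equal degree are isomorphic; β represents the image of a root of h'
  -- in `F[X]` / (h).
  obtain ⟨β, hβ⟩ : ∃ β : F[X], h.1 ∣ aeval β h'.1 := by
    have : Module.Finite F (AdjoinRoot h.1) := finite_quotient h.2.1
    have : Finite (AdjoinRoot h.1) := Module.finite_of_finite F
    have hrank : Module.finrank F (AdjoinRoot h'.1) = Module.finrank F (AdjoinRoot h.1) :=
      finrank_quotient_span_eq_natDegree.trans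
        (hd.symm.trans finrank_quotient_span_eq_natDegree.symm)
    obtain ⟨g⟩ : Nonempty (AdjoinRoot h'.1 →ₐ[F] AdjoinRoot h.1) :=
      FiniteField.nonempty_algHom_of_finrank_dvd (by rw [hrank])
    obtain ⟨β, hβ⟩ := AdjoinRoot.mk_surjective (g (AdjoinRoot.root h'.1))
    refine ⟨β, ?_⟩
    have h1 : AdjoinRoot.mk h.1 (aeval β h'.1) = aeval (AdjoinRoot.mk h.1 β) h'.1 :=
      (aeval_algHom_apply (AdjoinRoot.mkₐ (R := F) h.1) β h'.1).symm
    rw [← AdjoinRoot.mk_eq_zero, h1, hβ, aeval_algHom_apply, AdjoinRoot.aeval_eq,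
      AdjoinRoot.mk_self, map_zero]
  obtain ⟨w, hw⟩ := hβ
  -- If h² divides h'(β), replace β by β + h, as in Hensel's lemma: the Taylor expansion adds h
  -- times the derivative of h' at β, modulo h². This derivative is prime to h because h' is
  -- separable, F being perfect.
  by_cases hdw : h.1 ∣ w
  · obtain ⟨k, hk⟩ := binomExpansion (h'.1.map C) β h.1
    have haev : ∀ (p γ : F[X]), (p.map C).eval γ = aeval γ p := fun p γ => by
      rw [eval_map, aeval_def]; rfl
    rw [derivative_map, haev, haev, haev, hw] at hk
    refine ⟨β + h.1, w + aeval β (derivative h'.1) + k * h.1, by rw [hk]; ring, fun hdvd => ?_⟩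
    have hder : h.1 ∣ aeval β (derivative h'.1) :=
      (dvd_add_right hdw).1 ((dvd_add_left (Dvd.intro_left k rfl)).1 hdvd)
    obtain ⟨a, b, hab⟩ := PerfectField.separable_of_irreducible h'.2.2
    have hone := congrArg (aeval β) hab
    rw [map_add, map_mul, map_mul, map_one, hw] at hone
    refine h.2.2.not_isUnit (isUnit_of_dvd_one ?_)
    rw [← hone]
    exact dvd_add ((dvd_mul_right _ _).mul_left _) (hder.mul_left _)
  · exact ⟨β, w, hw, hdw⟩

/-- The substitution preserves valuations. Write p = h'^m p' with p' prime to h'; substituting γ in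
a Bézout identity shows that p'(γ) is prime to h, and h divides h'(γ) exactly once. -/
theorem dvd_pow_aeval_iff {h h' : Irr F} {γ w : F[X]} (hγ : aeval γ h'.1 = h.1 * w)
    (hw : ¬ h.1 ∣ w) (e : ℕ) (p : F[X]) : h.1 ^ e ∣ aeval γ p ↔ h'.1 ^ e ∣ p := by
  have hpr : Prime h.1 := h.2.2.prime
  constructor
  · intro hdvd
    by_cases hp0 : p = 0
    · simp [hp0]
    obtain ⟨p', hpp, hp'⟩ := (finiteMultiplicity_of_degree_pos_of_monic
      (degree_pos_of_irreducible h'.2.2) h'.2.1 hp0).exists_eq_pow_mul_and_not_dvd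
    obtain ⟨a, b, hab⟩ := (h'.2.2.coprime_iff_not_dvd).2 hp'
    have hone := congrArg (aeval γ) hab
    rw [map_add, map_mul, map_mul, map_one, hγ] at hone
    have hndvd : ¬ h.1 ∣ aeval γ p' := fun hd => by
      refine h.2.2.not_isUnit (isUnit_of_dvd_one ?_)
      rw [← hone]
      exact dvd_add ((dvd_mul_right _ _).mul_left _) (hd.mul_left _)
    rw [hpp, map_mul, map_pow, hγ, mul_pow] at hdvd
    have hdvd' := hpr.pow_dvd_of_dvd_mul_right e (fun hd => hw (hpr.dvd_of_dvd_pow hd))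
      (hpr.pow_dvd_of_dvd_mul_right e hndvd hdvd)
    rw [pow_dvd_pow_iff h.2.1.ne_zero h.2.2.not_isUnit] at hdvd'
    rw [hpp]
    exact (pow_dvd_pow _ hdvd').mul_right _
  · rintro ⟨r, rfl⟩
    rw [map_mul, map_pow, hγ, mul_pow, mul_assoc]
    exact dvd_mul_right _ _

/-- The bijection `F[X] / (h' ^ e) → F[X] / (h ^ e)` induced by a substitution. -/
theorem exists_semilinear_equiv {h h' : Irr F} (hd : h.1.natDegree = h'.1.natDegree) {γ w : F[X]}
    (hγ : aeval γ h'.1 = h.1 * w) (hw : ¬ h.1 ∣ w) (e : ℕ) :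
    ∃ σ : (F[X] ⧸ Ideal.span {h'.1 ^ e}) ≃+ (F[X] ⧸ Ideal.span {h.1 ^ e}),
      ∀ (p : F[X]) (v), σ (p • v) = aeval γ p • σ v := by
  have hiff := dvd_pow_aeval_iff hγ hw e
  let φ : (F[X] ⧸ Ideal.span {h'.1 ^ e}) →ₐ[F] (F[X] ⧸ Ideal.span {h.1 ^ e}) :=
    Ideal.quotientMapₐ _ (aeval γ) (by
      rw [Ideal.span_le, Set.singleton_subset_iff]
      exact Ideal.mem_span_singleton.2 ((hiff _).2 dvd_rfl))
  have hφ : ∀ p, φ (Ideal.Quotient.mk _ p) = Ideal.Quotient.mk _ (aeval γ p) := fun p => rfl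
  have hinj : Function.Injective φ := by
    rw [injective_iff_map_eq_zero]
    intro a ha
    obtain ⟨p, rfl⟩ := Ideal.Quotient.mk_surjective a
    rw [hφ, Ideal.Quotient.eq_zero_iff_dvd, hiff] at ha
    exact (Ideal.Quotient.eq_zero_iff_dvd _ _).2 ha
  have := finite_quotient (h.2.1.pow e)
  have := finite_quotient (h'.2.1.pow e)
  have hbij : Function.Bijective φ := by
    refine ⟨hinj, (LinearMap.injective_iff_surjective_of_finrank_eq_finrank
      (f := φ.toLinearMap) ?_).1 hinj⟩
    rw [finrank_quotient_span_eq_natDegree, finrank_quotient_span_eq_natDegree, natDegree_pow,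
      natDegree_pow, hd]
  refine ⟨AddEquiv.ofBijective φ hbij, fun p v => ?_⟩
  obtain ⟨v, rfl⟩ := Ideal.Quotient.mk_surjective v
  change φ (Ideal.Quotient.mk _ (p * v)) = Ideal.Quotient.mk _ (aeval γ p * aeval γ v)
  rw [hφ, map_mul]

theorem finite_autCard_Q [Finite F] (h : Irr F) (μ : Part) : Finite (Q h.1 μ ≃ₗ[F[X]] Q h.1 μ) := by
  have : Finite (Q h.1 μ) := Module.finite_of_finite F
  exact Finite.of_injective (fun f => (f : Q h.1 μ → Q h.1 μ)) DFunLike.coe_injective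

/-- Conjugation by the semilinear bijection T embeds one automorphism group in the other: a map
commuting with X commutes with γ. The converse is not needed, since exchanging h and h' yields the
reverse inequality. -/
theorem autCard_Q_le [Finite F] {h h' : Irr F} (hd : h.1.natDegree = h'.1.natDegree) (μ : Part) :
    autCard F[X] (Q h.1 μ) ≤ autCard F[X] (Q h'.1 μ) := by
  obtain ⟨γ, w, hγ, hw⟩ := exists_aeval_eq_mul h h' hd
  choose σ hσ using fun e => exists_semilinear_equiv hd hγ hw e
  let T : Q h'.1 μ ≃+ Q h.1 μ := AddEquiv.piCongrRight fun i => σ i.1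
  have hs : ∀ (p : F[X]) (v), T (p • v) = aeval γ p • T v := fun p v => by
    funext i
    exact hσ _ p (v i)
  have := finite_autCard_Q h' μ
  refine Nat.card_le_card_of_injective (fun g : Q h.1 μ ≃ₗ[F[X]] Q h.1 μ =>
    (((T.trans g.toAddEquiv).trans T.symm).toLinearEquiv fun p v => ?_ :
      Q h'.1 μ ≃ₗ[F[X]] Q h'.1 μ)) ?_
  · apply T.injective
    simp [hs]
  · intro g g' hg
    ext1 v
    have := LinearEquiv.congr_fun hg (T.symm v)
    simpa using this

theorem autCard_Q_eq [Finite F] {h h' : Irr F} (hd : h.1.natDegree = h'.1.natDegree) (μ : Part) :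
    autCard F[X] (Q h.1 μ) = autCard F[X] (Q h'.1 μ) :=
  (autCard_Q_le hd μ).antisymm (autCard_Q_le hd.symm μ)

end Q

/-! ### Cyclic decompositions as module isomorphisms -/

section HasType
variable {F V : Type*} [Field F] [AddCommGroup V] [Module F V]

theorem mem_primaryComponent_iff {f : Module.End F V} {h : F[X]} {v : V} :
    v ∈ primaryComponent f h ↔ ∃ k, aeval f (h ^ k) v = 0 := by
  rw [primaryComponent, Submodule.mem_iSup_of_directed]
  · simp only [LinearMap.mem_ker]
  · refine Monotone.directed_le fun a b hab v hv => ?_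
    rw [LinearMap.mem_ker] at hv ⊢
    obtain ⟨c, rfl⟩ := Nat.exists_eq_add_of_le hab
    rw [pow_add, mul_comm, map_mul, Module.End.mul_apply, hv, map_zero]

theorem mem_span_range_pow_iff {f : Module.End F V} {w v : V} :
    v ∈ Submodule.span F (Set.range fun k : ℕ => (f ^ k) w) ↔ ∃ p : F[X], aeval f p w = v := by
  constructor
  · intro hv
    induction hv using Submodule.span_induction with
    | mem x hx =>
      obtain ⟨k, rfl⟩ := hx
      exact ⟨X ^ k, by simp⟩
    | zero => exact ⟨0, by simp⟩
    | add x y _ _ hx hy =>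
      obtain ⟨p, rfl⟩ := hx
      obtain ⟨q, rfl⟩ := hy
      exact ⟨p + q, by simp⟩
    | smul a x _ hx =>
      obtain ⟨p, rfl⟩ := hx
      exact ⟨a • p, by simp⟩
  · rintro ⟨p, rfl⟩
    rw [aeval_eq_sum_range, LinearMap.sum_apply]
    exact Submodule.sum_mem _ fun k _ =>
      Submodule.smul_mem _ _ (Submodule.subset_span ⟨k, rfl⟩)

theorem aeval_aeval_comm (f : Module.End F V) (p q : F[X]) (v : V) :
    aeval f p (aeval f q v) = aeval f q (aeval f p v) := by
  rw [← Module.End.mul_apply, ← map_mul, mul_comm, map_mul, Module.End.mul_apply]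

theorem coe_aeval_restrict {f : Module.End F V} {W : Submodule F V} (hW : ∀ v ∈ W, f v ∈ W)
    (p : F[X]) (v : W) : ((aeval (f.restrict hW) p v : W) : V) = aeval f p (v : V) := by
  induction p using Polynomial.induction_on' with
  | add p q hp hq => simp [hp, hq]
  | monomial n a =>
    simp only [aeval_monomial, Module.End.mul_apply, Module.algebraMap_end_apply,
      Submodule.coe_smul]
    congr 1
    induction n generalizing v with
    | zero => simp
    | succ n ih => rw [pow_succ, pow_succ, Module.End.mul_apply, Module.End.mul_apply, ih]; rfl

/-- Polynomials in f commute, so one that kills a cyclic generator kills the whole cyclic subspace.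
-/
theorem aeval_restrict_eq_zero_iff {f : Module.End F V} {W : Submodule F V}
    (hW : ∀ v ∈ W, f v ∈ W) {w : V} (hw : W = Submodule.span F (Set.range fun k : ℕ => (f ^ k) w))
    (p : F[X]) : aeval (f.restrict hW) p = 0 ↔ aeval f p w = 0 := by
  constructor
  · intro h
    have hwW : w ∈ W := hw ▸ mem_span_range_pow_iff.2 ⟨1, by simp⟩
    have := coe_aeval_restrict hW p ⟨w, hwW⟩
    rw [h] at this
    simpa using this.symm
  · intro h
    ext ⟨v, hv⟩
    rw [coe_aeval_restrict]
    rw [hw] at hv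
    obtain ⟨q, rfl⟩ := mem_span_range_pow_iff.1 hv
    simp [aeval_aeval_comm f p q, h]

/-- The `h`-primary component as an `F[X]`-module. -/
noncomputable abbrev primaryModule (f : Module.End F V) (h : F[X]) : Submodule F[X] (Module.AEval' f) :=
  Submodule.torsion' F[X] (Module.AEval' f) (Submonoid.powers h)

theorem mem_primaryModule_iff {f : Module.End F V} {h : F[X]} {v : V} :
    Module.AEval'.of f v ∈ primaryModule f h ↔ v ∈ primaryComponent f h := by
  rw [mem_primaryComponent_iff, Submodule.mem_torsion'_iff]
  constructor
  · rintro ⟨⟨_, k, rfl⟩, hk⟩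
    exact ⟨k, hk⟩
  · rintro ⟨k, hk⟩
    exact ⟨⟨_, k, rfl⟩, hk⟩

/-- Send the class of p in factor i to p(f) w_i, with w_i a cyclic generator of W i. The minimal
polynomial makes each such map well defined and injective; independence makes their sum injective.
-/
theorem HasType.nonempty_equiv {f : Module.End F V} {h : F[X]} {μ : Part} (H : HasType f h μ) :
    Nonempty (Q h μ ≃ₗ[F[X]] primaryModule f h) := by
  obtain ⟨r, e, W, hW, hparts, hind, hsup, hcyc⟩ := H
  choose w hw using fun i => (hcyc i).1
  have hmin := fun i => (hcyc i).2
  have hker : ∀ i p, aeval f p (w i) = 0 ↔ h ^ e i ∣ p := fun i p => by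
    rw [← aeval_restrict_eq_zero_iff (hW i) (hw i), ← hmin i, minpoly.dvd_iff]
  obtain ⟨g⟩ := model_equiv_Q h e μ hparts
  let φ : ∀ i, (F[X] ⧸ Ideal.span {h ^ e i}) →ₗ[F[X]] Module.AEval' f := fun i =>
    Submodule.liftQ _ (LinearMap.toSpanSingleton F[X] _ (Module.AEval'.of f (w i))) (by
      intro p hp
      exact (hker i p).2 (Ideal.mem_span_singleton.1 hp))
  have hφ : ∀ i p, φ i (Ideal.Quotient.mk _ p) = Module.AEval'.of f (aeval f p (w i)) :=
    fun i p => rfl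
  let Φ : Model h e →ₗ[F[X]] Module.AEval' f := ∑ i, (φ i).comp (LinearMap.proj i)
  have hΦ : ∀ x, Φ x = ∑ i, φ i (x i) := fun x => by simp [Φ]
  have hΦ' : ∀ p : Fin r → F[X], Φ (fun i => Ideal.Quotient.mk _ (p i)) =
      Module.AEval'.of f (∑ i, aeval f (p i) (w i)) := fun p => by
    rw [hΦ, map_sum]
    rfl
  have hinj : Function.Injective Φ := by
    rw [injective_iff_map_eq_zero]
    intro x hx
    choose p hp using fun i => Ideal.Quotient.mk_surjective (x i)
    obtain rfl : (fun i => Ideal.Quotient.mk _ (p i)) = x := funext hp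
    rw [hΦ'] at hx
    have h0 := (iSupIndep_iff_finsetSum_eq_zero_imp_eq_zero W).1 hind Finset.univ
      (fun i => aeval f (p i) (w i))
      (fun i _ => (hw i).symm ▸ mem_span_range_pow_iff.2 ⟨p i, rfl⟩) hx
    funext i
    exact Ideal.Quotient.eq_zero_iff_mem.2
      (Ideal.mem_span_singleton.2 ((hker i (p i)).1 (h0 i (Finset.mem_univ _))))
  have hrange : LinearMap.range Φ = primaryModule f h := by
    ext v
    rw [← (Module.AEval'.of f).apply_symm_apply v, mem_primaryModule_iff, ← hsup,
      Submodule.mem_iSup_iff_exists_finsupp]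
    constructor
    · rintro ⟨x, hx⟩
      choose p hp using fun i => Ideal.Quotient.mk_surjective (x i)
      obtain rfl : (fun i => Ideal.Quotient.mk _ (p i)) = x := funext hp
      rw [hΦ'] at hx
      refine ⟨Finsupp.equivFunOnFinite.symm fun i => aeval f (p i) (w i), fun i => ?_, ?_⟩
      · rw [hw i]
        exact mem_span_range_pow_iff.2 ⟨p i, rfl⟩
      · rw [Finsupp.sum_fintype _ _ (fun _ => rfl)]
        exact hx
    · rintro ⟨x, hx, hxs⟩
      choose p hp using fun i => mem_span_range_pow_iff.1 (hw i ▸ hx i)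
      refine ⟨fun i => Ideal.Quotient.mk _ (p i), ?_⟩
      rw [hΦ', ← hxs, Finsupp.sum_fintype _ _ (fun _ => rfl)]
      simp only [hp]
  exact ⟨g.symm.trans ((LinearEquiv.ofInjective Φ hinj).trans (LinearEquiv.ofEq _ _ hrange))⟩

/-- The cyclic subspaces are generated by the images of the unit vectors of the model. -/
theorem exists_hasType_of_injective {ι : Type*} [Fintype ι] {f : Module.End F V} {h : F[X]}
    (hm : h.Monic) (k : ι → ℕ) (Φ : Model h k →ₗ[F[X]] Module.AEval' f)
    (hinj : Function.Injective Φ) (hrange : LinearMap.range Φ = primaryModule f h) :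
    ∃ μ, HasType f h μ := by
  classical
  let w : ι → V := fun i => (Module.AEval'.of f).symm (Φ (Pi.single i 1))
  have hΦ : ∀ i p, Φ (Pi.single i (Ideal.Quotient.mk _ p)) =
      Module.AEval'.of f (aeval f p (w i)) := fun i p => by
    have : (Pi.single i (Ideal.Quotient.mk _ p) : Model h k) = p • Pi.single i 1 := by
      rw [← Pi.single_smul]
      congr 1
      exact (congrArg _ (mul_one p)).symm
    rw [this, map_smul]
    rfl
  have hΦ' : ∀ p : ι → F[X], Φ (fun i => Ideal.Quotient.mk _ (p i)) =
      Module.AEval'.of f (∑ i, aeval f (p i) (w i)) := fun p => by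
    rw [← Finset.univ_sum_single (fun i => Ideal.Quotient.mk _ (p i)), map_sum, map_sum]
    exact Finset.sum_congr rfl fun i _ => hΦ i (p i)
  have hker : ∀ i p, aeval f p (w i) = 0 ↔ h ^ k i ∣ p := fun i p => by
    rw [← (Module.AEval'.of f).map_eq_zero_iff, ← hΦ, map_eq_zero_iff Φ hinj, Pi.single_eq_zero_iff,
      Ideal.Quotient.eq_zero_iff_mem, Ideal.mem_span_singleton]
  let W : ι → Submodule F V := fun i => Submodule.span F (Set.range fun j : ℕ => (f ^ j) (w i))
  have hWf : ∀ i, ∀ v ∈ W i, f v ∈ W i := fun i v hv => by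
    obtain ⟨p, rfl⟩ := mem_span_range_pow_iff.1 hv
    exact mem_span_range_pow_iff.2 ⟨X * p, by simp⟩
  have hind : iSupIndep W := by
    rw [iSupIndep_iff_finsetSum_eq_zero_imp_eq_zero]
    intro s v hv h0 i hi
    have hv' : ∀ j, ∃ p : F[X], aeval f p (w j) = if j ∈ s then v j else 0 := fun j => by
      split_ifs with hj
      · exact mem_span_range_pow_iff.1 (hv j hj)
      · exact ⟨0, by simp⟩
    choose p hp using hv'
    have hz : Φ (fun i => Ideal.Quotient.mk _ (p i)) = 0 := by
      rw [hΦ']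
      simp only [hp]
      rw [Finset.sum_ite_mem, Finset.univ_inter, h0, map_zero]
    have := congrFun ((map_eq_zero_iff Φ hinj).1 hz) i
    rw [Pi.zero_apply, Ideal.Quotient.eq_zero_iff_mem, Ideal.mem_span_singleton, ← hker, hp,
      if_pos hi] at this
    exact this
  have hsup : ⨆ i, W i = primaryComponent f h := by
    ext v
    rw [← mem_primaryModule_iff, ← hrange, Submodule.mem_iSup_iff_exists_finsupp]
    constructor
    · rintro ⟨x, hx, hxs⟩
      choose p hp using fun i => mem_span_range_pow_iff.1 (hx i)
      refine ⟨fun i => Ideal.Quotient.mk _ (p i), ?_⟩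
      rw [hΦ', ← hxs, Finsupp.sum_fintype _ _ (fun _ => rfl)]
      simp only [hp]
    · rintro ⟨x, hx⟩
      choose p hp using fun i => Ideal.Quotient.mk_surjective (x i)
      obtain rfl : (fun i => Ideal.Quotient.mk _ (p i)) = x := funext hp
      rw [hΦ'] at hx
      refine ⟨Finsupp.equivFunOnFinite.symm fun i => aeval f (p i) (w i), fun i => ?_, ?_⟩
      · exact mem_span_range_pow_iff.2 ⟨p i, rfl⟩
      · rw [Finsupp.sum_fintype _ _ (fun _ => rfl)]
        exact hx
  have hbot : ∀ i, k i = 0 → W i = ⊥ := fun i hi => by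
    have : w i = 0 := by simpa [hi] using (hker i 1)
    simp [W, this]
  -- Zero exponents are allowed in k but not as parts. Their subspaces are zero and are dropped,
  -- just as `Nat.Partition.ofMultiset` drops the zeros.
  let σ := (Fintype.equivFin {i // k i ≠ 0}).symm
  refine ⟨⟨_, Nat.Partition.ofMultiset (Multiset.map k Finset.univ.val)⟩,
    Fintype.card {i // k i ≠ 0}, fun j => k (σ j).1, fun j => W (σ j).1, fun j => hWf _, ?_,
    hind.comp (Subtype.val_injective.comp σ.injective), ?_, fun j => ⟨⟨_, rfl⟩, ?_⟩⟩
  · rw [Nat.Partition.ofMultiset_parts]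
    have h1 : Multiset.map σ Finset.univ.val = Finset.univ.val := Multiset.map_univ_val_equiv σ
    have h2 : Multiset.map Subtype.val (Finset.univ : Finset {i // k i ≠ 0}).val =
        Multiset.filter (fun i => k i ≠ 0) Finset.univ.val := by
      have := congrArg Finset.val (Finset.subtype_map (fun i => k i ≠ 0) (s := Finset.univ))
      rwa [Finset.subtype_univ] at this
    rw [Multiset.filter_map]
    change _ = Multiset.map k (Multiset.filter (fun i => k i ≠ 0) Finset.univ.val)
    rw [← h2, ← h1, Multiset.map_map, Multiset.map_map]
    rfl
  · rw [← hsup]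
    refine le_antisymm (iSup_le fun j => le_iSup W _) (iSup_le fun i => ?_)
    by_cases hi : k i = 0
    · rw [hbot i hi]
      exact bot_le
    · refine le_iSup_of_le (σ.symm ⟨i, hi⟩) ?_
      simp only [σ.apply_symm_apply, le_refl]
  · have hd : ∀ p : F[X], minpoly F (f.restrict (hWf (σ j).1)) ∣ p ↔ h ^ k (σ j).1 ∣ p := fun p => by
      rw [minpoly.dvd_iff, aeval_restrict_eq_zero_iff (hWf _) rfl, hker]
    refine eq_of_monic_of_associated (minpoly.monic ?_) (hm.pow _)
      (associated_of_dvd_dvd ((hd _).2 dvd_rfl) ((hd _).1 dvd_rfl))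
    refine ⟨h ^ k (σ j).1, hm.pow _, ?_⟩
    exact minpoly.dvd_iff.1 ((hd _).2 dvd_rfl)

theorem exists_hasType [Module.Finite F V] (f : Module.End F V) (h : Irr F) :
    ∃ μ, HasType f h.1 μ := by
  have hfin : Module.Finite F[X] (Module.AEval' f) := inferInstance
  have : IsNoetherian F[X] (Module.AEval' f) := isNoetherian_of_isNoetherianRing_of_finite _ _
  obtain ⟨d, k, ⟨g⟩⟩ := Module.torsion_by_prime_power_decomposition h.2.2
    (M := primaryModule f h.1) (Submodule.torsion'_isTorsion' _)
  let g' : Model h.1 k ≃ₗ[F[X]] primaryModule f h.1 :=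
    (g.trans (DirectSum.linearEquivFunOnFintype F[X] (Fin d) _)).symm
  refine exists_hasType_of_injective h.2.1 k ((primaryModule f h.1).subtype.comp g'.toLinearMap)
    (Subtype.val_injective.comp g'.injective) ?_
  rw [LinearMap.range_comp, LinearEquiv.range, Submodule.map_top, Submodule.range_subtype]

end HasType

/-! ### Matrices, modules and similarity -/

section Matrix
variable {F : Type*} [Field F] {n : ℕ}

/-- The `F[X]`-module of row vectors on which `X` acts by `v ↦ v A`. -/
abbrev RowModule (A : Matrix (Fin n) (Fin n) F) : Type _ :=
  Module.AEval' (Matrix.vecMulLinear A : Module.End F (Fin n → F))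

theorem exists_aeval_sub_aeval_eq_mul {R : Type*} [Ring R] [Algebra F R] {x y : R}
    (hxy : Commute x y) (p : F[X]) : ∃ b, aeval x p - aeval y p = (x - y) * b := by
  induction p using Polynomial.induction_on' with
  | add p q hp hq =>
    obtain ⟨b, hb⟩ := hp
    obtain ⟨c, hc⟩ := hq
    refine ⟨b + c, ?_⟩
    rw [mul_add, ← hb, ← hc, map_add, map_add]
    abel
  | monomial k a =>
    refine ⟨a • ∑ i ∈ Finset.range k, x ^ i * y ^ (k - 1 - i), ?_⟩
    rw [mul_smul_comm, hxy.mul_geom_sum₂, smul_sub, aeval_monomial, aeval_monomial,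
      ← Algebra.smul_def, ← Algebra.smul_def]

/-- Since p(A) = 0, the matrix p(X) · 1 = p(X) - p(A) is a multiple of X - A; take determinants.
Hence primes not dividing p cannot divide the characteristic polynomial. -/
theorem charpoly_dvd_pow {A : Matrix (Fin n) (Fin n) F} {p : F[X]} (hp : aeval A p = 0) :
    A.charpoly ∣ p ^ n := by
  obtain ⟨b, hb⟩ := exists_aeval_sub_aeval_eq_mul (commute_X (C A)) p
  have hC : aeval (C A) p = 0 := by
    have := aeval_algHom_apply (CAlgHom (R := F) (A := Matrix (Fin n) (Fin n) F)) A p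
    rw [hp, map_zero] at this
    exact this
  have hX : aeval (X : (Matrix (Fin n) (Fin n) F)[X]) p =
      p.map (algebraMap F (Matrix (Fin n) (Fin n) F)) := by
    have := aeval_algHom_apply (mapAlgHom (Algebra.ofId F (Matrix (Fin n) (Fin n) F))) X p
    rw [aeval_X_left_apply, coe_mapAlgHom, Polynomial.map_X] at this
    exact this
  rw [hC, sub_zero, hX] at hb
  have h2 : p • (1 : Matrix (Fin n) (Fin n) F[X]) = A.charmatrix * matPolyEquiv.symm b := by
    apply matPolyEquiv.injective
    rw [map_mul, matPolyEquiv_smul_one, Matrix.matPolyEquiv_charmatrix, AlgEquiv.apply_symm_apply]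
    exact hb
  have h3 := congrArg Matrix.det h2
  rw [Matrix.det_smul, Matrix.det_one, mul_one, Fintype.card_fin, Matrix.det_mul] at h3
  exact ⟨_, h3⟩

theorem aeval_vecMulLinear (A : Matrix (Fin n) (Fin n) F) (p : F[X]) (v : Fin n → F) :
    aeval (Matrix.vecMulLinear A : Module.End F (Fin n → F)) p v =
      Matrix.vecMul v (aeval A p) := by
  induction p using Polynomial.induction_on' with
  | add p q hp hq => rw [map_add, map_add, LinearMap.add_apply, hp, hq, Matrix.vecMul_add]
  | monomial k a =>
    rw [aeval_monomial, aeval_monomial, Module.End.mul_apply, Module.algebraMap_end_apply,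
      ← Algebra.smul_def, Matrix.vecMul_smul]
    congr 1
    induction k generalizing v with
    | zero => simp
    | succ k ih =>
      rw [pow_succ, Module.End.mul_apply, ih, Matrix.vecMulLinear_apply, Matrix.vecMul_vecMul,
        ← pow_succ']

theorem ext_of_vecMul {A B : Matrix (Fin n) (Fin n) F}
    (h : ∀ v : Fin n → F, Matrix.vecMul v A = Matrix.vecMul v B) : A = B :=
  LinearMap.toMatrixRight'.symm.injective (LinearMap.ext h)

theorem smul_rowModule_eq_zero_iff (A : Matrix (Fin n) (Fin n) F) (p : F[X]) :
    (∀ v : RowModule A, p • v = 0) ↔ aeval A p = 0 := by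
  constructor
  · intro h
    refine ext_of_vecMul fun v => ?_
    rw [Matrix.vecMul_zero]
    exact (aeval_vecMulLinear A p v).symm.trans (h _)
  · intro h v
    refine (aeval_vecMulLinear A p ((Module.AEval'.of _).symm v)).trans ?_
    rw [h, Matrix.vecMul_zero]
    rfl

theorem charpoly_smul (A : Matrix (Fin n) (Fin n) F) (v : RowModule A) : A.charpoly • v = 0 :=
  (smul_rowModule_eq_zero_iff A _).2 (Matrix.aeval_self_charpoly A) v

theorem lam_spec (A : Matrix (Fin n) (Fin n) F) (h : Irr F) :
    HasType (Matrix.vecMulLinear A : Module.End F (Fin n → F)) h.1 (lam A h) :=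
  Classical.epsilon_spec (exists_hasType (Matrix.vecMulLinear A : Module.End F (Fin n → F)) h)

theorem torsionBy_eq_primaryModule {A : Matrix (Fin n) (Fin n) F} {S : Finset (Irr F)} {N : ℕ}
    (hA : A.charpoly ∣ ∏ h ∈ S, h.1 ^ N) (h : S) :
    Submodule.torsionBy F[X] (RowModule A) (h.1.1 ^ N) = primaryModule _ h.1.1 := by
  classical
  ext v
  rw [Submodule.mem_torsionBy_iff, Submodule.mem_torsion'_iff]
  constructor
  · exact fun hv => ⟨⟨_, N, rfl⟩, hv⟩
  · rintro ⟨⟨_, k, rfl⟩, hk⟩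
    replace hk : h.1.1 ^ k • v = 0 := hk
    obtain ⟨q, hq⟩ := hA
    have h0 : (∏ j ∈ S, j.1 ^ N) • v = 0 := by
      rw [hq, mul_comm, mul_smul, charpoly_smul, smul_zero]
    rw [← Finset.mul_prod_erase S _ h.2] at h0
    have hc : IsCoprime (h.1.1 ^ k) (∏ j ∈ S.erase h.1, j.1 ^ N) :=
      IsCoprime.prod_right fun j hj => (isCoprime_of_ne (Finset.ne_of_mem_erase hj).symm).pow
    obtain ⟨a, b, hab⟩ := hc
    -- The vector h^N v is killed by h^k and by the product of the other prime powers, which are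
    -- coprime, so it is zero.
    rw [← one_smul F[X] (h.1.1 ^ N • v), ← hab, add_smul, mul_smul, mul_smul,
      smul_comm _ (h.1.1 ^ N) v, hk, ← mul_smul _ (h.1.1 ^ N) v, mul_comm _ (h.1.1 ^ N), h0]
    simp

theorem rowModule_equiv {A : Matrix (Fin n) (Fin n) F} {S : Finset (Irr F)} {N : ℕ}
    (hA : A.charpoly ∣ ∏ h ∈ S, h.1 ^ N) :
    Nonempty (RowModule A ≃ₗ[F[X]] ∀ h : S, Q h.1.1 (lam A h.1)) := by
  classical
  have hint := Submodule.torsionBy_isInternal (R := F[X]) (M := RowModule A) (S := S)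
    (q := fun h => h.1 ^ N) (fun i _ j _ hij => (isCoprime_of_ne hij).pow) (fun v => by
      obtain ⟨q, hq⟩ := hA
      rw [hq, mul_comm, mul_smul, charpoly_smul, smul_zero])
  have g := fun h : S => (lam_spec A h.1).nonempty_equiv.some
  let g1 := (LinearEquiv.ofBijective (DirectSum.coeLinearMap fun h : S =>
    Submodule.torsionBy F[X] (RowModule A) (h.1.1 ^ N)) hint).symm
  let g2 := DirectSum.linearEquivFunOnFintype F[X] S fun h : S =>
    Submodule.torsionBy F[X] (RowModule A) (h.1.1 ^ N)
  exact ⟨(g1.trans g2).trans (LinearEquiv.piCongrRight fun h =>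
    (LinearEquiv.ofEq _ _ (torsionBy_eq_primaryModule hA h)).trans (g h).symm)⟩

/-- A is the matrix of multiplication by X in an F-basis of M. -/
theorem exists_rowModule_equiv {M : Type*} [AddCommGroup M] [Module F M] [Module F[X] M]
    [IsScalarTower F F[X] M] [Module.Finite F M] (hM : Module.finrank F M = n) :
    ∃ A : Matrix (Fin n) (Fin n) F, Nonempty (RowModule A ≃ₗ[F[X]] M) := by
  let e : (Fin n → F) ≃ₗ[F] M := ((Module.finBasisOfFinrankEq F M hM).equivFun).symm
  let t : M →ₗ[F] M := (LinearMap.lsmul F[X] M X).restrictScalars F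
  let f : (Fin n → F) →ₗ[F] (Fin n → F) := e.symm.toLinearMap.comp (t.comp e.toLinearMap)
  refine ⟨f.toMatrixRight', ⟨LinearEquiv.ofAEval _ e fun m => ?_⟩⟩
  have : (Matrix.vecMulLinear f.toMatrixRight' : Module.End F (Fin n → F)) = f :=
    LinearMap.toMatrixRight'.symm_apply_apply f
  rw [this]
  exact e.apply_symm_apply _

/-- The map v ↦ v g respects the actions of X exactly when A g = g B. This covers both similarity
and, for A = B, the centraliser. -/
theorem nonempty_intertwiners_equiv (A B : Matrix (Fin n) (Fin n) F) :
    Nonempty ({g : GL (Fin n) F // A * (g : Matrix (Fin n) (Fin n) F) = g * B} ≃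
      (RowModule A ≃ₗ[F[X]] RowModule B)) := by
  have hinv : ∀ g : GL (Fin n) F, ∀ v : Fin n → F,
      Matrix.vecMul (Matrix.vecMul v (g : Matrix (Fin n) (Fin n) F)) (g⁻¹ : GL (Fin n) F) = v :=
    fun g v => by rw [Matrix.vecMul_vecMul, Units.mul_inv, Matrix.vecMul_one]
  let toEquiv : GL (Fin n) F → ((Fin n → F) ≃ₗ[F] (Fin n → F)) := fun g =>
    { Matrix.vecMulLinear (g : Matrix (Fin n) (Fin n) F) with
      invFun := fun v => Matrix.vecMul v (g⁻¹ : GL (Fin n) F)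
      left_inv := hinv g
      right_inv := fun v => by
        have := hinv g⁻¹ v
        rwa [inv_inv] at this }
  refine ⟨Equiv.ofBijective (fun g => LinearEquiv.ofAEval _
    ((toEquiv g.1).trans (Module.AEval'.of _)) fun v => ?_) ⟨?_, ?_⟩⟩
  · have : Matrix.vecMul (Matrix.vecMul v A) g.1 =
        Matrix.vecMul (Matrix.vecMul v (g.1 : Matrix (Fin n) (Fin n) F)) B := by
      rw [Matrix.vecMul_vecMul, g.2, Matrix.vecMul_vecMul]
    exact (congrArg (Module.AEval'.of _) this).trans (Module.AEval'.X_smul_of _ _).symm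
  · intro g g' hg
    refine Subtype.ext (Units.ext (ext_of_vecMul fun v => ?_))
    exact LinearEquiv.congr_fun hg (Module.AEval'.of _ v)
  · intro φ
    let f : (Fin n → F) →ₗ[F] (Fin n → F) :=
      (Module.AEval'.of _).symm.toLinearMap.comp ((φ.restrictScalars F).toLinearMap.comp
        (Module.AEval'.of _).toLinearMap)
    let f' : (Fin n → F) →ₗ[F] (Fin n → F) :=
      (Module.AEval'.of _).symm.toLinearMap.comp ((φ.symm.restrictScalars F).toLinearMap.comp
        (Module.AEval'.of _).toLinearMap)
    have hff' : f'.comp f = LinearMap.id := LinearMap.ext fun v => φ.symm_apply_apply v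
    have hf'f : f.comp f' = LinearMap.id := LinearMap.ext fun v => φ.apply_symm_apply v
    let g : GL (Fin n) F := ⟨f.toMatrixRight', f'.toMatrixRight',
      by rw [← LinearMap.toMatrixRight'_comp, hff', LinearMap.toMatrixRight'_id],
      by rw [← LinearMap.toMatrixRight'_comp, hf'f, LinearMap.toMatrixRight'_id]⟩
    have hg : ∀ v, Matrix.vecMul v (g : Matrix (Fin n) (Fin n) F) = f v := fun v =>
      LinearMap.congr_fun (LinearMap.toMatrixRight'.symm_apply_apply f) v
    refine ⟨⟨g, ?_⟩, ?_⟩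
    · refine ext_of_vecMul fun v => ?_
      rw [← Matrix.vecMul_vecMul, ← Matrix.vecMul_vecMul, hg, hg]
      have := map_smul φ (X : F[X]) (Module.AEval'.of _ v)
      rw [Module.AEval'.X_smul_of] at this
      exact this.trans (Module.AEval'.X_smul_of _ (f v))
    · refine LinearEquiv.ext fun v => ?_
      exact hg v

theorem centralizerOrder_eq (A : Matrix (Fin n) (Fin n) F) :
    centralizerOrder A = autCard F[X] (RowModule A) := by
  rw [autCard, ← Nat.card_congr (nonempty_intertwiners_equiv A A).some, centralizerOrder]
  exact Nat.card_congr (Equiv.subtypeEquivRight fun g => eq_comm)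

/-- Orbit-stabiliser for conjugation by `GL (Fin n) F`. -/
theorem card_similar_mul_autCard (A : Matrix (Fin n) (Fin n) F) :
    Nat.card {B : Matrix (Fin n) (Fin n) F // Nonempty (RowModule B ≃ₗ[F[X]] RowModule A)} *
      autCard F[X] (RowModule A) = Nat.card (GL (Fin n) F) := by
  have h := Nat.card_congr (MulAction.orbitProdStabilizerEquivGroup (ConjAct (GL (Fin n) F)) A)
  rw [Nat.card_prod] at h
  have hG : Nat.card (ConjAct (GL (Fin n) F)) = Nat.card (GL (Fin n) F) :=
    Nat.card_congr ConjAct.ofConjAct.toEquiv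
  rw [← hG, ← h, ← centralizerOrder_eq]
  congr 1
  · refine Nat.card_congr (Equiv.subtypeEquivRight fun B => ?_)
    constructor
    · rintro ⟨φ⟩
      obtain ⟨g, hg⟩ := (nonempty_intertwiners_equiv B A).some.symm φ
      refine ⟨ConjAct.toConjAct g, ?_⟩
      change (g : Matrix (Fin n) (Fin n) F) * A * (g⁻¹ : GL (Fin n) F) = B
      rw [← hg, Matrix.mul_assoc, Units.mul_inv, Matrix.mul_one]
    · rintro ⟨g, rfl⟩
      refine ⟨(nonempty_intertwiners_equiv _ A).some ⟨ConjAct.ofConjAct g, ?_⟩⟩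
      change (_ * A * ((ConjAct.ofConjAct g)⁻¹ : GL (Fin n) F) : Matrix (Fin n) (Fin n) F) * _ = _
      rw [Matrix.mul_assoc, Units.inv_mul, Matrix.mul_one]
  · refine Nat.card_congr (ConjAct.ofConjAct.toEquiv.symm.subtypeEquiv fun g => ?_)
    rw [MulAction.mem_stabilizer_iff]
    change _ ↔ (g : Matrix (Fin n) (Fin n) F) * A * (g⁻¹ : GL (Fin n) F) = A
    constructor
    · intro h
      rw [h, Matrix.mul_assoc, Units.mul_inv, Matrix.mul_one]
    · intro h
      nth_rw 2 [← h]
      rw [Matrix.mul_assoc, Units.inv_mul, Matrix.mul_one]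

end Matrix

/-! ### Types of matrices and the size of a similarity class -/

section Lam
variable {F : Type*} [Field F] {n : ℕ}

theorem finrank_pi_Q (S : Finset (Irr F)) (τ : Irr F → Part) :
    Module.finrank F (∀ h : S, Q h.1.1 (τ h.1)) = ∑ h ∈ S, (τ h).size * h.1.natDegree := by
  have : ∀ h : S, Module.Finite F (Q h.1.1 (τ h.1)) := fun h => finite_Q h.1 _
  rw [Module.finrank_pi_fintype,
    ← Finset.sum_coe_sort S (fun h => (τ h).size * h.1.natDegree)]
  exact Finset.sum_congr rfl fun h _ => finrank_Q h.1.2.1 _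

theorem charpoly_dvd_of_equiv {A : Matrix (Fin n) (Fin n) F} {S : Finset (Irr F)}
    {τ : Irr F → Part} (g : RowModule A ≃ₗ[F[X]] ∀ h : S, Q h.1.1 (τ h.1)) :
    A.charpoly ∣ (∏ h ∈ S, h.1 ^ (τ h).size) ^ n := by
  refine charpoly_dvd_pow ((smul_rowModule_eq_zero_iff A _).1 fun v => g.injective ?_)
  rw [map_smul, map_zero]
  funext h
  obtain ⟨q, hq⟩ := Finset.dvd_prod_of_mem (fun h : Irr F => h.1 ^ (τ h).size) h.2
  rw [hq, mul_comm, mul_smul, Pi.smul_apply, Pi.smul_apply, pow_smul_Q_eq_zero le_rfl, smul_zero,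
    Pi.zero_apply]

theorem exists_charpoly_dvd_of_equiv {A : Matrix (Fin n) (Fin n) F} {S : Finset (Irr F)}
    {τ : Irr F → Part} (g : RowModule A ≃ₗ[F[X]] ∀ h : S, Q h.1.1 (τ h.1)) :
    ∃ N, A.charpoly ∣ ∏ h ∈ S, h.1 ^ N := by
  refine ⟨(∑ h ∈ S, (τ h).size) * n, (charpoly_dvd_of_equiv g).trans ?_⟩
  rw [← Finset.prod_pow]
  refine Finset.prod_dvd_prod_of_dvd _ _ fun h hh => ?_
  rw [← pow_mul]
  exact pow_dvd_pow _ (Nat.mul_le_mul_right _ (Finset.single_le_sum_of_canonicallyOrdered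
    (f := fun h => (τ h).size) hh))

theorem lam_eq_of_equiv [Finite F] {A : Matrix (Fin n) (Fin n) F} {S : Finset (Irr F)}
    {τ : Irr F → Part} (g : RowModule A ≃ₗ[F[X]] ∀ h : S, Q h.1.1 (τ h.1)) {h : Irr F}
    (hh : h ∈ S) : lam A h = τ h := by
  obtain ⟨N, hN⟩ := exists_charpoly_dvd_of_equiv g
  obtain ⟨g'⟩ := rowModule_equiv hN
  exact eq_of_pi_Q_equiv (τ := lam A) (g'.symm.trans g) h hh

theorem exists_dvd_prod_pow {p : F[X]} (hp : p ≠ 0) {S : Finset (Irr F)}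
    (hS : ∀ h : Irr F, h.1 ∣ p → h ∈ S) : ∃ N, p ∣ ∏ h ∈ S, h.1 ^ N := by
  classical
  have key : ∀ s : Multiset F[X], (∀ a ∈ s, a ∣ ∏ h ∈ S, h.1) →
      s.prod ∣ (∏ h ∈ S, h.1) ^ s.card := by
    intro s
    induction s using Multiset.induction with
    | empty => simp
    | cons a s ih =>
      intro hs
      rw [Multiset.prod_cons, Multiset.card_cons, pow_succ']
      exact mul_dvd_mul (hs a (Multiset.mem_cons_self a s))
        (ih fun b hb => hs b (Multiset.mem_cons_of_mem hb))
  refine ⟨(UniqueFactorizationMonoid.normalizedFactors p).card, ?_⟩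
  rw [Finset.prod_pow]
  refine (UniqueFactorizationMonoid.prod_normalizedFactors hp).symm.dvd.trans (key _ fun a ha => ?_)
  obtain ⟨h1, h2, h3⟩ := (Polynomial.mem_normalizedFactors_iff hp).1 ha
  exact Finset.dvd_prod_of_mem (fun h : Irr F => h.1) (hS ⟨a, h2, h1⟩ h3)

theorem mem_Div_iff {A : Matrix (Fin n) (Fin n) F} {h : Irr F} : h ∈ Div A ↔ h.1 ∣ A.charpoly := by
  rw [Div, Set.Finite.mem_toFinset, Set.mem_ofPred_eq]

theorem rowModule_equiv_of_Div_subset {A : Matrix (Fin n) (Fin n) F} {S : Finset (Irr F)}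
    (hS : Div A ⊆ S) : Nonempty (RowModule A ≃ₗ[F[X]] ∀ h : S, Q h.1.1 (lam A h.1)) := by
  obtain ⟨N, hN⟩ := exists_dvd_prod_pow A.charpoly_monic.ne_zero
    fun h hh => hS (mem_Div_iff.2 hh)
  exact rowModule_equiv hN

/-- An empty type leaves h out of an annihilator of the module, and the characteristic polynomial
divides a power of that annihilator. Conversely, if h does not divide it, the h-component is killed
by two coprime polynomials and vanishes. -/
theorem mem_Div_iff_lam_ne {A : Matrix (Fin n) (Fin n) F} {h : Irr F} :
    h ∈ Div A ↔ lam A h ≠ Part.empty := by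
  constructor
  · intro hh hlam
    obtain ⟨g⟩ := rowModule_equiv_of_Div_subset (A := A) subset_rfl
    have h1 := (mem_Div_iff.1 hh).trans (charpoly_dvd_of_equiv g)
    obtain ⟨j, -, hj⟩ := h.2.2.prime.exists_mem_finset_dvd (h.2.2.prime.dvd_of_dvd_pow h1)
    have hj' : h = j := Subtype.ext (eq_of_monic_of_associated h.2.1 j.2.1
      (h.2.2.associated_of_dvd j.2.2 (h.2.2.prime.dvd_of_dvd_pow hj)))
    rw [← hj', hlam] at hj
    have hone : h.1 ∣ h.1 ^ 0 := hj
    rw [pow_zero] at hone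
    exact h.2.2.not_isUnit (isUnit_of_dvd_one hone)
  · contrapose!
    intro hh
    rw [mem_Div_iff] at hh
    obtain ⟨g⟩ := (lam_spec A h).nonempty_equiv
    have hc : IsCoprime (h.1 ^ (lam A h).size) A.charpoly :=
      ((h.2.2.coprime_iff_not_dvd).2 hh).pow_left
    have h0 := hom_eq_zero_of_isCoprime hc (fun x => pow_smul_Q_eq_zero le_rfl x)
      (fun x => Subtype.ext (charpoly_smul A x.1)) g.toLinearMap
    have hsub : Subsingleton (Q h.1 (lam A h)) := by
      refine ⟨fun x y => g.injective ?_⟩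
      exact (LinearMap.congr_fun h0 x).trans (LinearMap.congr_fun h0 y).symm
    have hz := finrank_Q h.2.1 (lam A h)
    rw [Module.finrank_zero_of_subsingleton] at hz
    exact eq_empty_of_size_eq_zero
      ((Nat.mul_eq_zero.1 hz.symm).resolve_right (natDegree_pos h).ne')

/-- The product over a single factor. -/
theorem nonempty_pi_singleton_equiv (h : Irr F) (τ : Irr F → Part) :
    Nonempty ((∀ j : ({h} : Finset (Irr F)), Q j.1.1 (τ j.1)) ≃ₗ[F[X]] Q h.1 (τ h)) := by
  let _ : Unique ({h} : Finset (Irr F)) := ⟨⟨⟨h, Finset.mem_singleton_self h⟩⟩, fun x =>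
    Subtype.ext (Finset.mem_singleton.1 x.2)⟩
  exact ⟨LinearEquiv.piUnique F[X] (fun j : ({h} : Finset (Irr F)) => Q j.1.1 (τ j.1))⟩

/-- The characteristic polynomial divides a power of h, so it is one; its degree n fixes the
exponent. -/
theorem charpoly_eq_pow_of_equiv {h : Irr F} {μ : Part}
    {A : Matrix (Fin n) (Fin n) F} (g : RowModule A ≃ₗ[F[X]] Q h.1 μ) :
    A.charpoly = h.1 ^ μ.size := by
  obtain ⟨g'⟩ := nonempty_pi_singleton_equiv h fun _ => μ
  have h1 := charpoly_dvd_of_equiv (τ := fun _ => μ) (g.trans g'.symm)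
  rw [Finset.prod_singleton, ← pow_mul, dvd_prime_pow h.2.2.prime] at h1
  obtain ⟨k, -, hk⟩ := h1
  have hA := eq_of_monic_of_associated A.charpoly_monic (h.2.1.pow k) hk
  have hdeg := congrArg natDegree hA
  have hn : n = μ.size * h.1.natDegree := by
    rw [← finrank_Q h.2.1 μ, ← (g.restrictScalars F).finrank_eq]
    exact (Module.finrank_fin_fun F).symm
  rw [Matrix.charpoly_natDegree_eq_dim, Fintype.card_fin, natDegree_pow, hn] at hdeg
  rw [hA, Nat.eq_of_mul_eq_mul_right (natDegree_pos h) hdeg]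

theorem c_eq_autCard [Finite F] (h : Irr F) (μ : Part) :
    c F μ h.1.natDegree = autCard F[X] (Q h.1 μ) := by
  by_cases hμ : μ = Part.empty
  · subst hμ
    rw [c, if_pos rfl]
    have : Subsingleton (Q h.1 Part.empty) := by
      have : Module.finrank F (Q h.1 Part.empty) = 0 := by rw [finrank_Q h.2.1]; simp
      have hfin : Module.Finite F (Q h.1 Part.empty) := finite_Q h _
      exact Module.finrank_zero_iff.1 this
    have : Unique (Q h.1 Part.empty ≃ₗ[F[X]] Q h.1 Part.empty) :=
      ⟨⟨LinearEquiv.refl _ _⟩, fun f => LinearEquiv.ext fun x => Subsingleton.elim _ _⟩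
    exact Nat.card_unique.symm
  · rw [c, if_neg hμ]
    have hex : ∃ m : ℕ, ∃ (j : Irr F) (A : Matrix (Fin (μ.size * h.1.natDegree))
        (Fin (μ.size * h.1.natDegree)) F), j.1.natDegree = h.1.natDegree ∧
        A.charpoly = j.1 ^ μ.size ∧ lam A j = μ ∧ centralizerOrder A = m := by
      obtain ⟨A, ⟨g⟩⟩ := exists_rowModule_equiv (finrank_Q h.2.1 μ)
      obtain ⟨g'⟩ := nonempty_pi_singleton_equiv h fun _ => μ
      exact ⟨_, h, A, rfl, charpoly_eq_pow_of_equiv g,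
        lam_eq_of_equiv (τ := fun _ => μ) (g.trans g'.symm) (Finset.mem_singleton_self h), rfl⟩
    -- The chosen value may come from another irreducible j of the same degree; `autCard_Q_eq`
    -- brings it back to h.
    obtain ⟨j, A, hj, hA, hlam, hcard⟩ := Classical.epsilon_spec hex
    rw [← hcard, centralizerOrder_eq]
    obtain ⟨g⟩ := rowModule_equiv (A := A) (S := {j}) (N := μ.size) (by
      rw [Finset.prod_singleton, hA])
    obtain ⟨g'⟩ := nonempty_pi_singleton_equiv j (lam A)
    rw [autCard_congr (g.trans g'), hlam]
    exact autCard_Q_eq hj μ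

theorem natDegree_le_of_mem_Div {A : Matrix (Fin n) (Fin n) F} {h : Irr F} (hh : h ∈ Div A) :
    h.1.natDegree ≤ n := by
  have := natDegree_le_of_dvd (mem_Div_iff.1 hh) A.charpoly_monic.ne_zero
  rwa [Matrix.charpoly_natDegree_eq_dim, Fintype.card_fin] at this

theorem sum_size_lam {A : Matrix (Fin n) (Fin n) F} {S : Finset (Irr F)} (hS : Div A ⊆ S) :
    ∑ h ∈ S, (lam A h).size * h.1.natDegree = n := by
  obtain ⟨g⟩ := rowModule_equiv_of_Div_subset hS
  rw [← finrank_pi_Q, ← (g.restrictScalars F).finrank_eq]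
  exact Module.finrank_fin_fun F

/-- The number of matrices of given type times the order of the centraliser of one of them. -/
theorem card_type_mul_prod_c [Finite F] {S : Finset (Irr F)}
    (hS : ∀ h : Irr F, h.1.natDegree ≤ n → h ∈ S) {τ : Irr F → Part}
    (hτ : ∑ h ∈ S, (τ h).size * h.1.natDegree = n) :
    Nat.card {A : Matrix (Fin n) (Fin n) F // ∀ h ∈ S, lam A h = τ h} *
      ∏ h ∈ S, c F (τ h) h.1.natDegree = Nat.card (GL (Fin n) F) := by
  have : ∀ h : S, Module.Finite F (Q h.1.1 (τ h.1)) := fun h => finite_Q h.1 _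
  obtain ⟨A, ⟨g⟩⟩ := exists_rowModule_equiv ((finrank_pi_Q S τ).trans hτ)
  rw [← card_similar_mul_autCard A, autCard_congr g, autCard_pi_Q]
  simp only [c_eq_autCard]
  congr 1
  -- The matrices of the given type form the similarity class of A. As S contains every irreducible
  -- of degree at most n, it contains `Div B`, so the types on S determine the module of B.
  refine Nat.card_congr (Equiv.subtypeEquivRight fun B => ⟨fun hB => ?_, ?_⟩)
  · obtain ⟨g'⟩ := rowModule_equiv_of_Div_subset (A := B) (S := S)
      fun h hh => hS h (natDegree_le_of_mem_Div hh)
    have g'' : (∀ h : S, Q h.1.1 (lam B h.1)) ≃ₗ[F[X]] ∀ h : S, Q h.1.1 (τ h.1) :=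
      LinearEquiv.piCongrRight fun h => by
        rw [hB h.1 h.2]
    exact ⟨(g'.trans g'').trans g.symm⟩
  · rintro ⟨g'⟩ h hh
    exact lam_eq_of_equiv (g'.trans g) hh

end Lam

/-! ### Generating functions and convergence -/

section Series
variable {F : Type*} [Field F]

theorem finite_natDegree_le [Finite F] (n : ℕ) : {h : Irr F | h.1.natDegree ≤ n}.Finite := by
  refine Set.Finite.of_injOn (f := fun (h : Irr F) (i : Fin (n + 1)) => h.1.coeff i)
    (t := Set.univ) (fun _ _ => Set.mem_univ _) (fun h hh h' hh' heq => ?_) Set.finite_univ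
  refine Subtype.ext ((ext_iff_natDegree_le hh hh').2 fun i hi => ?_)
  exact congrFun heq ⟨i, Nat.lt_succ_of_le hi⟩

/-- The monic irreducible polynomials of degree at most `n`. -/
noncomputable def irrLE (F : Type*) [Field F] [Finite F] (n : ℕ) : Finset (Irr F) :=
  (finite_natDegree_le n).toFinset

theorem mem_irrLE [Finite F] {n : ℕ} {h : Irr F} : h ∈ irrLE F n ↔ h.1.natDegree ≤ n := by
  rw [irrLE, Set.Finite.mem_toFinset, Set.mem_ofPred_eq]

/-- The partitions of size at most `n`. -/
def partLE (n : ℕ) : Finset Part := (Finset.range (n + 1)).sigma fun _ => Finset.univ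

theorem mem_partLE {n : ℕ} {μ : Part} : μ ∈ partLE n ↔ μ.size ≤ n := by
  simp [partLE]

theorem size_le_mul (h : Irr F) (μ : Part) : μ.size ≤ μ.size * h.1.natDegree :=
  Nat.le_mul_of_pos_right _ (natDegree_pos h)

theorem coeff_term_eq_zero {h : Irr F} {μ : Part} {k : ℕ} (hk : k ≠ μ.size * h.1.natDegree) :
    PowerSeries.coeff k (term h μ) = 0 := by
  rw [term, PowerSeries.coeff_monomial, if_neg hk]

theorem coeff_prod_congr {R ι : Type*} [CommRing R] {s : Finset ι} {n : ℕ}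
    {f g : ι → PowerSeries R}
    (H : ∀ i ∈ s, ∀ k ≤ n, PowerSeries.coeff k (f i) = PowerSeries.coeff k (g i)) :
    PowerSeries.coeff n (∏ i ∈ s, f i) = PowerSeries.coeff n (∏ i ∈ s, g i) := by
  classical
  rw [PowerSeries.coeff_prod, PowerSeries.coeff_prod]
  refine Finset.sum_congr rfl fun l hl => Finset.prod_congr rfl fun i hi => H i hi _ ?_
  rw [Finset.mem_finsuppAntidiag] at hl
  rw [← hl.1]
  exact Finset.single_le_sum_of_canonicallyOrdered hi

theorem hasFiniteSupport_coeff_term (h : Irr F) (k : ℕ) :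
    (Function.support fun μ : {μ : Part // μ ≠ Part.empty} =>
      PowerSeries.coeff k (term h μ.1)).Finite := by
  refine Set.Finite.subset ((partLE k).finite_toSet.preimage Subtype.val_injective.injOn)
    fun μ hμ => ?_
  rw [Set.mem_preimage, Finset.mem_coe, mem_partLE]
  by_contra hlt
  exact hμ (coeff_term_eq_zero (by have := size_le_mul h μ.1; omega))

section Sums
variable [TopologicalSpace (CoeffRing F)]

theorem summable_term (h : Irr F) :
    Summable fun μ : {μ : Part // μ ≠ Part.empty} => term h μ.1 :=
  (PowerSeries.WithPiTopology.summable_iff_summable_coeff _).2 fun k =>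
    summable_of_hasFiniteSupport (hasFiniteSupport_coeff_term h k)

/-- A partition larger than k contributes nothing in degree k. Bounding by n instead of k lets one
finite index set serve all the degrees used in a product. -/
theorem coeff_tsum_term [DiscreteTopology (CoeffRing F)] (h : Irr F) {k n : ℕ} (hkn : k ≤ n) :
    PowerSeries.coeff k (∑' μ : {μ : Part // μ ≠ Part.empty}, term h μ.1) =
      ∑ μ ∈ (partLE n).erase Part.empty, PowerSeries.coeff k (term h μ) := by
  classical
  have h1 := (PowerSeries.WithPiTopology.hasSum_iff_hasSum_coeff _).1 (summable_term h).hasSum k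
  have h2 : HasSum (fun μ : {μ : Part // μ ≠ Part.empty} => PowerSeries.coeff k (term h μ.1))
      (∑ μ ∈ (partLE n).subtype (fun μ => μ ≠ Part.empty), PowerSeries.coeff k (term h μ.1)) := by
    refine hasSum_sum_of_ne_finset_zero fun μ hμ => coeff_term_eq_zero ?_
    rw [Finset.mem_subtype, mem_partLE] at hμ
    have := size_le_mul h μ.1
    omega
  rw [h1.unique h2, ← Finset.filter_ne']
  exact Finset.sum_subtype_eq_sum_filter fun μ => PowerSeries.coeff k (term h μ)

end Sums

open Classical in
/-- The contribution of `h` and `μ` to the cycle index. -/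
noncomputable def weight (I : Finset (Irr F)) (h : Irr F) (μ : Part) : CoeffRing F :=
  if μ = Part.empty ∧ h ∉ I then 1 else x h μ

open Classical in
/-- The factor of the product formula belonging to `h`. -/
noncomputable def factor [TopologicalSpace (CoeffRing F)] (I : Finset (Irr F)) (h : Irr F) :
    PowerSeries (CoeffRing F) :=
  (if h ∈ I then PowerSeries.C (x h Part.empty) else 1) +
    ∑' μ : {μ : Part // μ ≠ Part.empty}, term h μ.1

theorem c_empty (d : ℕ) : c F Part.empty d = 1 := by rw [c, if_pos rfl]

/-- Because c((), d, q) = 1, the constant term is the summand of the empty partition, and `weight`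
absorbs the distinction between h ∈ I and h ∉ I. -/
theorem coeff_factor [TopologicalSpace (CoeffRing F)] [DiscreteTopology (CoeffRing F)]
    (I : Finset (Irr F)) (h : Irr F) {k n : ℕ} (hkn : k ≤ n) :
    PowerSeries.coeff k (factor I h) = PowerSeries.coeff k (∑ μ ∈ partLE n,
      PowerSeries.monomial (μ.size * h.1.natDegree)
        (MvPolynomial.C (1 / (c F μ h.1.natDegree : ℚ)) * weight I h μ)) := by
  classical
  have he : Part.empty ∈ partLE n := mem_partLE.2 (Nat.zero_le n)
  rw [factor, map_add, coeff_tsum_term h hkn, map_sum, ← Finset.add_sum_erase _ _ he]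
  congr 1
  · have h0 : Part.empty.size * h.1.natDegree = 0 := Nat.zero_mul _
    rw [h0, c_empty, Nat.cast_one, div_one, MvPolynomial.C_1, one_mul, weight,
      PowerSeries.monomial_zero_eq_C_apply]
    by_cases hI : h ∈ I
    · simp [hI]
    · simp [hI]
  · refine Finset.sum_congr rfl fun μ hμ => ?_
    rw [weight, if_neg fun hh => Finset.ne_of_mem_erase hμ hh.1, term]

theorem prod_monomial {R ι : Type*} [CommRing R] (s : Finset ι) (d : ι → ℕ) (a : ι → R) :
    ∏ i ∈ s, PowerSeries.monomial (d i) (a i) =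
      PowerSeries.monomial (∑ i ∈ s, d i) (∏ i ∈ s, a i) := by
  classical
  induction s using Finset.induction_on with
  | empty => simp
  | insert i s hi ih =>
    rw [Finset.prod_insert hi, Finset.sum_insert hi, Finset.prod_insert hi, ih,
      PowerSeries.monomial_mul_monomial]

theorem prod_x_eq_prod_weight [DecidableEq (Irr F)] {n : ℕ} {A : Matrix (Fin n) (Fin n) F}
    {I S : Finset (Irr F)} (hI : I ⊆ S) (hS : Div A ⊆ S) :
    ∏ h ∈ Div A ∪ I, x h (lam A h) = ∏ h ∈ S, weight I h (lam A h) := by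
  rw [← Finset.prod_subset (Finset.union_subset hS hI) (f := fun h => weight I h (lam A h))]
  · refine Finset.prod_congr rfl fun h hh => ?_
    rw [weight, if_neg]
    rintro ⟨h1, h2⟩
    rcases Finset.mem_union.1 hh with h3 | h3
    · exact mem_Div_iff_lam_ne.1 h3 h1
    · exact h2 h3
  · intro h _ hh
    rw [Finset.mem_union, not_or, mem_Div_iff_lam_ne, not_not] at hh
    rw [weight, if_pos hh]

/-- Expanding the product gives one monomial for each choice t of partitions on S; grouping the
matrices by their types on S gives the same indexing, and the class size supplies the coefficient.
-/
theorem Z_eq_coeff_prod [Fintype F] [TopologicalSpace (CoeffRing F)]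
    [DiscreteTopology (CoeffRing F)] {I S : Finset (Irr F)} {n : ℕ} (hI : I ⊆ S)
    (hS : irrLE F n ⊆ S) : Z I n = PowerSeries.coeff n (∏ h ∈ S, factor I h) := by
  classical
  have hDiv : ∀ A : Matrix (Fin n) (Fin n) F, Div A ⊆ S := fun A h hh =>
    hS (mem_irrLE.2 (natDegree_le_of_mem_Div hh))
  rw [coeff_prod_congr fun h _ k hk => coeff_factor I h hk, ← Finset.prod_coe_sort,
    Finset.prod_univ_sum, map_sum]
  simp only [prod_monomial]
  let r : Matrix (Fin n) (Fin n) F → S → Part := fun A h => lam A h.1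
  have hr : ∀ A ∈ (Finset.univ : Finset (Matrix (Fin n) (Fin n) F)),
      r A ∈ Fintype.piFinset fun _ : S => partLE n := fun A _ => by
    rw [Fintype.mem_piFinset]
    intro h
    rw [mem_partLE]
    refine (size_le_mul h.1 _).trans ?_
    rw [← sum_size_lam (hDiv A)]
    exact Finset.single_le_sum_of_canonicallyOrdered
      (f := fun h => (lam A h).size * h.1.natDegree) h.2
  have hGL : (Nat.card (GL (Fin n) F) : ℚ) ≠ 0 := Nat.cast_ne_zero.2 Nat.card_pos.ne'
  rw [Z]
  simp only [prod_x_eq_prod_weight hI (hDiv _)]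
  rw [← Finset.sum_fiberwise_of_maps_to hr, Finset.mul_sum]
  refine Finset.sum_congr rfl fun t _ => ?_
  have hconst : ∀ A ∈ Finset.univ.filter (fun A => r A = t),
      ∏ h ∈ S, weight I h (lam A h) = ∏ h : S, weight I h.1 (t h) := fun A hA => by
    rw [← (Finset.mem_filter.1 hA).2]
    exact (Finset.prod_coe_sort S fun h => weight I h (lam A h)).symm
  rw [Finset.sum_congr rfl hconst, Finset.sum_const, PowerSeries.coeff_monomial,
    Finset.prod_mul_distrib]
  let τ : Irr F → Part := fun h => if hh : h ∈ S then t ⟨h, hh⟩ else Part.empty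
  have hτ : ∀ h : S, τ h.1 = t h := fun h => dif_pos h.2
  have hsum : ∑ h : S, (t h).size * h.1.1.natDegree = ∑ h ∈ S, (τ h).size * h.1.natDegree := by
    rw [← Finset.sum_coe_sort S]
    simp only [hτ]
  split_ifs with hn
  · have hc := card_type_mul_prod_c (S := S) (τ := τ) (fun h hh => hS (mem_irrLE.2 hh))
      (hsum.symm.trans hn.symm)
    have hfil : Nat.card {A : Matrix (Fin n) (Fin n) F // ∀ h ∈ S, lam A h = τ h} =
        (Finset.univ.filter fun A => r A = t).card := by
      rw [← Fintype.card_subtype, ← Nat.card_eq_fintype_card]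
      refine Nat.card_congr (Equiv.subtypeEquivRight fun A => ?_)
      constructor
      · exact fun hA => funext fun h => (hA h.1 h.2).trans (hτ h)
      · exact fun hA h hh => (congrFun hA ⟨h, hh⟩).trans (hτ ⟨h, hh⟩).symm
    rw [hfil, ← Finset.prod_coe_sort] at hc
    simp only [hτ] at hc
    rw [← hc] at hGL
    rw [← map_prod, nsmul_eq_mul, ← mul_assoc]
    congr 1
    rw [← map_natCast (MvPolynomial.C : ℚ →+* CoeffRing F), ← map_mul, ← hc,
      Finset.prod_div_distrib]
    congr 1
    push_cast at hGL ⊢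
    have h1 := left_ne_zero_of_mul hGL
    have h2 := right_ne_zero_of_mul hGL
    rw [Finset.prod_const_one]
    field_simp
  -- A choice of partitions with total degree different from n is the type of no n × n matrix.
  · have : Finset.univ.filter (fun A => r A = t) = ∅ := by
      rw [Finset.filter_eq_empty_iff]
      rintro A - rfl
      refine hn ?_
      rw [← sum_size_lam (hDiv A)]
      exact (Finset.sum_coe_sort S fun h => (lam A h).size * h.1.natDegree).symm
    rw [this, Finset.card_empty, zero_smul, mul_zero]

/-- The only 0 × 0 matrix has all its types empty, so the separate constant term of `genFun` is no
exception to the general formula. -/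
theorem Z_zero [Fintype F] (I : Finset (Irr F)) : Z I 0 = ∏ h ∈ I, x h Part.empty := by
  classical
  have hD : ∀ A : Matrix (Fin 0) (Fin 0) F, Div A = ∅ := fun A =>
    Finset.eq_empty_of_forall_notMem fun h hh =>
      absurd (natDegree_le_of_mem_Div hh) (natDegree_pos h).not_ge
  have hl : ∀ (A : Matrix (Fin 0) (Fin 0) F) h, lam A h = Part.empty := fun A h => by
    by_contra hh
    have := mem_Div_iff_lam_ne.2 hh
    rw [hD] at this
    exact Finset.notMem_empty _ this
  have hcard : Fintype.card (Matrix (Fin 0) (Fin 0) F) = 1 :=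
    Fintype.card_eq_one_iff.2 ⟨0, fun A => Subsingleton.elim _ _⟩
  rw [Z]
  simp [hD, hl, hcard]

theorem coeff_genFun [Fintype F] (I : Finset (Irr F)) (n : ℕ) :
    PowerSeries.coeff n (genFun I) = Z I n := by
  rw [genFun, PowerSeries.coeff_mk]
  split_ifs with hn
  · rw [hn, Z_zero]
  · rfl

theorem multipliable_one_add_tsum_term [Finite F] [TopologicalSpace (CoeffRing F)]
    [DiscreteTopology (CoeffRing F)] (I : Finset (Irr F)) :
    Multipliable fun h : {h : Irr F // h ∉ I} =>
      1 + ∑' μ : {μ : Part // μ ≠ Part.empty}, term h.1 μ.1 := by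
  classical
  set f := fun h : {h : Irr F // h ∉ I} =>
    1 + ∑' μ : {μ : Part // μ ≠ Part.empty}, term h.1 μ.1 with hf
  let S : ℕ → Finset {h : Irr F // h ∉ I} := fun n => (irrLE F n).subtype fun h => h ∉ I
  refine ⟨PowerSeries.mk fun n => PowerSeries.coeff n (∏ h ∈ S n, f h), ?_⟩
  rw [HasProd, SummationFilter.unconditional_filter,
    PowerSeries.WithPiTopology.tendsto_iff_coeff_tendsto]
  intro n
  -- A factor with deg h > n is 1 modulo u^(n+1), so enlarging the product beyond `S n` does not
  -- alter the coefficient of u^n.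
  refine tendsto_atTop_of_eventually_const (i₀ := S n) fun T hT => ?_
  rw [PowerSeries.coeff_mk]
  have hcong : PowerSeries.coeff n (∏ h ∈ T, f h) =
      PowerSeries.coeff n (∏ h ∈ T, if h ∈ S n then f h else 1) := by
    refine coeff_prod_congr fun h _ k hk => ?_
    split_ifs with hh
    · rfl
    · rw [Finset.mem_subtype, mem_irrLE, not_le] at hh
      rw [hf, map_add, coeff_tsum_term h.1 le_rfl, Finset.sum_eq_zero, add_zero]
      intro μ hμ
      have h1 : μ.size ≠ 0 := fun h0 =>
        Finset.ne_of_mem_erase hμ (eq_empty_of_size_eq_zero h0)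
      have h2 := Nat.le_mul_of_pos_left h.1.1.natDegree (Nat.pos_of_ne_zero h1)
      exact coeff_term_eq_zero (by omega)
  rw [hcong, Finset.prod_ite_mem, Finset.inter_eq_right.2 hT]

theorem genFun_eq_tprod_mul_prod [Fintype F] [TopologicalSpace (CoeffRing F)]
    [DiscreteTopology (CoeffRing F)] (I : Finset (Irr F)) :
    genFun I = (∏' h : {h : Irr F // h ∉ I},
        (1 + ∑' μ : {μ : Part // μ ≠ Part.empty}, term h.1 μ.1)) *
      ∏ h ∈ I, (PowerSeries.C (x h Part.empty) +
        ∑' μ : {μ : Part // μ ≠ Part.empty}, term h μ.1) := by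
  classical
  have h1 : ∀ h : {h : Irr F // h ∉ I},
      1 + ∑' μ : {μ : Part // μ ≠ Part.empty}, term h.1 μ.1 = factor I h.1 := fun h => by
    rw [factor, if_neg h.2]
  have h2 : ∏ h ∈ I, (PowerSeries.C (x h Part.empty) +
      ∑' μ : {μ : Part // μ ≠ Part.empty}, term h μ.1) = ∏ h ∈ I, factor I h :=
    Finset.prod_congr rfl fun h hh => by rw [factor, if_pos hh]
  have hlim := (multipliable_one_add_tsum_term I).hasProd
  rw [h2]
  simp only [h1] at hlim ⊢
  rw [HasProd, SummationFilter.unconditional_filter] at hlim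
  -- Both sides are limits of the same partial products: over T ∪ I, the coefficient of u^n equals
  -- `Z I n` as soon as T contains the irreducibles outside I of degree at most n.
  refine tendsto_nhds_unique ?_ (hlim.mul_const _)
  rw [PowerSeries.WithPiTopology.tendsto_iff_coeff_tendsto]
  intro n
  refine tendsto_atTop_of_eventually_const
    (i₀ := (irrLE F n).subtype fun h => h ∉ I) fun T hT => ?_
  have hdisj : Disjoint (T.map (Function.Embedding.subtype _)) I := by
    rw [Finset.disjoint_left]
    intro h hh
    obtain ⟨j, -, rfl⟩ := Finset.mem_map.1 hh
    exact j.2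
  have hsub : irrLE F n ⊆ T.map (Function.Embedding.subtype _) ∪ I := by
    intro h hh
    rw [Finset.mem_union, or_iff_not_imp_right]
    intro hI
    exact Finset.mem_map.2 ⟨⟨h, hI⟩, hT (Finset.mem_subtype.2 hh), rfl⟩
  rw [coeff_genFun, Z_eq_coeff_prod Finset.subset_union_right hsub, Finset.prod_union hdisj,
    Finset.prod_map]
  rfl

end Series

end CycleIndex

theorem theorem3 {F : Type*} [Field F] [Fintype F] (I : Finset (CycleIndex.Irr F)) :
    letI : TopologicalSpace (CycleIndex.CoeffRing F) := ⊥
    (∀ h : CycleIndex.Irr F,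
      Summable fun μ : {μ : CycleIndex.Part // μ ≠ CycleIndex.Part.empty} =>
        CycleIndex.term h μ.1) ∧
    (Multipliable fun h : {h : CycleIndex.Irr F // h ∉ I} =>
      1 + ∑' μ : {μ : CycleIndex.Part // μ ≠ CycleIndex.Part.empty}, CycleIndex.term h.1 μ.1) ∧
    CycleIndex.genFun I =
      (∏' h : {h : CycleIndex.Irr F // h ∉ I},
        (1 + ∑' μ : {μ : CycleIndex.Part // μ ≠ CycleIndex.Part.empty},
          CycleIndex.term h.1 μ.1)) *
      ∏ h ∈ I, (PowerSeries.C (CycleIndex.x h CycleIndex.Part.empty) +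
        ∑' μ : {μ : CycleIndex.Part // μ ≠ CycleIndex.Part.empty}, CycleIndex.term h μ.1) := by
  -- With discrete coefficients, convergence of power series means that each coefficient is
  -- eventually constant.
  let _ : TopologicalSpace (CycleIndex.CoeffRing F) := ⊥
  have : DiscreteTopology (CycleIndex.CoeffRing F) := ⟨rfl⟩
  exact ⟨CycleIndex.summable_term, CycleIndex.multipliable_one_add_tsum_term I,
    CycleIndex.genFun_eq_tprod_mul_prod I⟩
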